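/- All graphs are finite, simple and undirected. Let $n\ge 4$ and let $P_n$ be the path with $n$ vertices. For a graph $G$, let $HL(G)$ be the graph whose vertices are the edges of $G$, two of them being adjacent if they are distinct, share an end vertex, and lie in a common subgraph of $G$ isomorphic to $P_n$. Put $HL^0(G)=G$ and $HL^{k+1}(G)=HL(HL^k(G))$. Let $\Lambda_n$ be the set of all graphs $G$ whose sequence $\{HL^k(G)\}$ converges, i.e. $HL^N(G)\cong HL^{N+1}(G)$ for some $N$, and the sequence does not reach the empty graph (the graph without vertices). Let $G\in\Lambda_n$ be unicyclic, i.e. connected with exactly one cycle $C$, and let $r$ be a root of $G$, i.e. a vertex of $C$ that is adjacent to some vertex of a connected component of $G-C$ (the graph obtained by deleting the vertices of $C$). Then the subgraph of $HL(G)$ induced by the set of edges of $G$ incident to $r$ (regarded as vertices of $HL(G)$) contains no cycle of length $4$ or more. -/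

import Mathlib

universe u v

namespace HLineGraph

/-- Two edges `e`, `f` of `G` are `H`-adjacent if they are adjacent edges (distinct, with a common
end vertex) and both lie in a common subgraph of `G` isomorphic to `H`. -/
def HAdjacent {W : Type v} (H : SimpleGraph W) {V : Type u} (G : SimpleGraph V)
    (e f : G.edgeSet) : Prop :=
  G.lineGraph.Adj e f ∧
    ∃ K : G.Subgraph, Nonempty (H ≃g K.coe) ∧ (e : Sym2 V) ∈ K.edgeSet ∧ (f : Sym2 V) ∈ K.edgeSet

/-- The `H`-line graph `HL(G)`: its vertices are the edges of `G`, and two of them are adjacent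
if they are `H`-adjacent in `G`. -/
def HL {W : Type v} (H : SimpleGraph W) {V : Type u} (G : SimpleGraph V) :
    SimpleGraph G.edgeSet where
  Adj e f := HAdjacent H G e f
  symm := ⟨fun _ _ h => ⟨h.1.symm, h.2.imp fun _ hK => ⟨hK.1, hK.2.2, hK.2.1⟩⟩⟩
  loopless := ⟨fun _ h => h.1.ne rfl⟩

/-- The iterates `HL^k(G)`, each bundled with its vertex type:
`HL^0(G) = G` and `HL^(k+1)(G) = HL(HL^k(G))`. -/
def iterHL {W : Type v} (H : SimpleGraph W) {V : Type u} (G : SimpleGraph V) :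
    ℕ → (X : Type u) × SimpleGraph X
  | 0 => ⟨V, G⟩
  | k + 1 => ⟨(iterHL H G k).2.edgeSet, HL H (iterHL H G k).2⟩

/-- The sequence `HL^k(G)` terminates if it reaches the empty graph, the graph without vertices
(a graph without edges is followed by it in the sequence). -/
def Terminates {W : Type v} (H : SimpleGraph W) {V : Type u} (G : SimpleGraph V) : Prop :=
  ∃ k : ℕ, IsEmpty (iterHL H G k).1

/-- The sequence `HL^k(G)` converges if two consecutive graphs in it are isomorphic and it does not
terminate. -/
def Converges {W : Type v} (H : SimpleGraph W) {V : Type u} (G : SimpleGraph V) : Prop :=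
  (∃ N : ℕ, Nonempty ((iterHL H G N).2 ≃g (iterHL H G (N + 1)).2)) ∧ ¬ Terminates H G

/-- `G ∈ Λ_n`: the sequence of iterated `H`-line graphs of `G` converges, where `H = P_n` is the
path with `n` vertices. -/
def MemLambda (n : ℕ) {V : Type u} (G : SimpleGraph V) : Prop :=
  Converges (SimpleGraph.pathGraph n) G

/-- The subgraph `C` of `G` is a cycle. -/
def IsCycleSubgraph {V : Type u} {G : SimpleGraph V} (C : G.Subgraph) : Prop :=
  ∃ (v : V) (p : G.Walk v v), p.IsCycle ∧ p.toSubgraph = C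

/-- A graph is unicyclic if it is connected and contains exactly one cycle. -/
def IsUnicyclic {V : Type u} (G : SimpleGraph V) : Prop :=
  G.Connected ∧ ∃! C : G.Subgraph, IsCycleSubgraph C

/-- The arms of `G` with respect to the cycle `C`: the connected components of `G - C`, the graph
that is left when the vertices of `C` are deleted. -/
abbrev Arm {V : Type u} {G : SimpleGraph V} (C : G.Subgraph) : Type u :=
  (G.induce (C.vertsᶜ)).ConnectedComponent

/-- `r` is a root of `G` (to be used for unicyclic `G`): a vertex of the cycle of `G` that is
adjacent to some vertex of an arm. -/
def IsRoot {V : Type u} (G : SimpleGraph V) (r : V) : Prop :=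
  ∃ C : G.Subgraph, IsCycleSubgraph C ∧ r ∈ C.verts ∧
    ∃ A : Arm C, ∃ u ∈ A.supp, G.Adj r u

/-- The set of the edges of `G` that are incident to `r`, as a set of vertices of `HL(G)`. -/
def edgesAt {V : Type u} (G : SimpleGraph V) (r : V) : Set G.edgeSet :=
  {e | r ∈ (e : Sym2 V)}

end HLineGraph

/-! Suppose that the edges at $r$ carry a cycle of length at least 4 in $HL(G)$. Then some iterate
has a cycle of length $m \ge n$ with a further edge at one of its vertices (`HasChordedCycle`). This
configuration reproduces itself with $m+1$ in place of $m$ (`HasChordedCycle.HL_succ`), so the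
iterates have unbounded order, whereas in a convergent sequence of finite graphs the order is
eventually constant (`Diverges.not_converges`).

Two configurations lead there. In a lollipop, a cycle with one arm, each step moves one vertex from
the arm to the cycle and keeps the total size above $n$, until the arm has length 1
(`HasLollipop.diverges`). In a ring, a cycle with several arms, each step shortens all arms and
lengthens all arcs by one; once some arm is used up, a lollipop or a long cycle with a chord is
present (`IsRing.diverges`).

Both are found among longest paths (legs) starting along the edges $ru$. If $ru$ and $rv$ are
adjacent in $HL(G)$, their legs have at least $n$ vertices in total, $r$ counted once. As $C$ is the
only cycle, two legs can meet only if both start along $C$, and at most two edges at $r$ lie on $C$.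
A leg that reaches $n$ vertices when extended backwards through $r$ by one neighbour gives a
lollipop on the assumed cycle. Otherwise take the shortest leg off $C$, starting along $rb$, and the
neighbours $rx$, $ry$ of $rb$ on the assumed cycle. Any other leg off $C$ is at least as long, hence
can stand in for that of $b$. So $b,x,y$ give a ring with three arms, or, if $rx$ and $ry$ both lie
on $C$, the vertices $b,x,a,y$ with another $ra$ off $C$ give one with four. -/

namespace HLineGraph

/-! ### Edges of a vertex sequence -/

section EdgeList

variable {α : Type*}

/-- The list of the pairs of consecutive entries of a list. -/
def edgeList : List α → List (Sym2 α)
  | [] => []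
  | [_] => []
  | a :: b :: l => s(a, b) :: edgeList (b :: l)

@[simp] theorem edgeList_nil : edgeList ([] : List α) = [] := rfl

@[simp] theorem edgeList_singleton (a : α) : edgeList [a] = [] := rfl

@[simp] theorem edgeList_cons_cons (a b : α) (l : List α) :
    edgeList (a :: b :: l) = s(a, b) :: edgeList (b :: l) := rfl

@[simp] theorem length_edgeList (l : List α) : (edgeList l).length = l.length - 1 := by
  induction l using edgeList.induct <;> simp_all

theorem edgeList_append (l₁ : List α) (v : α) (l₂ : List α) :
    edgeList (l₁ ++ v :: l₂) = edgeList (l₁ ++ [v]) ++ edgeList (v :: l₂) := by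
  induction l₁ using edgeList.induct <;> simp_all

theorem mem_of_mem_edgeList {l : List α} {e : Sym2 α} (he : e ∈ edgeList l) {v : α} (hv : v ∈ e) :
    v ∈ l := by
  induction l using edgeList.induct with
  | case1 => simp at he
  | case2 => simp at he
  | case3 a b l ih =>
    rw [edgeList_cons_cons, List.mem_cons] at he
    rcases he with rfl | he
    · rcases Sym2.mem_iff.1 hv with rfl | rfl <;> simp
    · exact List.mem_cons_of_mem _ (ih he)

theorem nodup_edgeList {l : List α} (hl : l.Nodup) : (edgeList l).Nodup := by
  induction l using edgeList.induct with
  | case1 => simp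
  | case2 => simp
  | case3 a b l ih =>
    rw [List.nodup_cons] at hl
    rw [edgeList_cons_cons, List.nodup_cons]
    exact ⟨fun h => hl.1 (mem_of_mem_edgeList h (Sym2.mem_mk_left a b)), ih hl.2⟩

theorem nodup_edgeList_closed {z : α} {l : List α} (hl : (z :: l).Nodup) (h2 : 2 ≤ l.length) :
    (edgeList (z :: l ++ [z])).Nodup := by
  obtain ⟨b, c, l, rfl⟩ : ∃ b c l', l = b :: c :: l' := by
    rcases l with _ | ⟨b, _ | ⟨c, l⟩⟩
    · simp at h2
    · simp at h2
    · exact ⟨b, c, l, rfl⟩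
  have h1 : (b :: c :: l ++ [z]).Nodup := by
    have : (b :: c :: l ++ [z]).Perm (z :: b :: c :: l) := List.perm_append_singleton _ _
    exact this.nodup_iff.2 hl
  have h3 := nodup_edgeList h1
  simp only [List.cons_append, edgeList_cons_cons, List.nodup_cons, List.mem_cons] at h3 ⊢
  refine ⟨?_, h3⟩
  rintro (h | h)
  · have hz : z ∈ s(b, c) := h ▸ Sym2.mem_mk_left z b
    simp only [Sym2.mem_iff] at hz
    grind
  · have := mem_of_mem_edgeList h (Sym2.mem_mk_right z b)
    grind

theorem edgeList_isChain {R : Sym2 α → Sym2 α → Prop} {l : List α}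
    (h : ∀ u v w, [u, v, w] <:+: l → R s(u, v) s(v, w)) : (edgeList l).IsChain R := by
  induction l using edgeList.induct with
  | case1 => simp
  | case2 => simp
  | case3 a b l ih =>
    have ih' := ih fun u v w huvw => h u v w (huvw.trans (List.suffix_cons a _).isInfix)
    rcases l with _ | ⟨c, l⟩
    · simp
    · simp only [edgeList_cons_cons] at ih' ⊢
      exact List.isChain_cons_cons.2 ⟨h a b c (List.IsPrefix.isInfix ⟨l, rfl⟩), ih'⟩

/-- Two consecutive edges involve only three consecutive vertices, and no such triple contains both
`a` and `b`. Thus chains obtained from different long paths can be glued. -/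
theorem edgeList_isChain_overlap {R : Sym2 α → Sym2 α → Prop} {a b : α} {l : List α}
    (hl : 2 ≤ l.length) (h₁ : (edgeList (a :: l)).IsChain R) (h₂ : (edgeList (l ++ [b])).IsChain R) :
    (edgeList (a :: l ++ [b])).IsChain R := by
  obtain ⟨c, d, l, rfl⟩ : ∃ c d l', l = c :: d :: l' := by
    rcases l with _ | ⟨b, _ | ⟨c, l⟩⟩
    · simp at hl
    · simp at hl
    · exact ⟨b, c, l, rfl⟩
  simp only [edgeList_cons_cons, List.cons_append, List.isChain_cons_cons] at h₁ h₂ ⊢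
  exact ⟨h₁.1, h₂⟩

end EdgeList

/-! ### Paths and adjacency in the line graph -/

section PathLists

variable {V : Type u} {G : SimpleGraph V} {n : ℕ}

/-- A list of vertices that traces a path of the graph. -/
def IsPathList (G : SimpleGraph V) (l : List V) : Prop :=
  l.Nodup ∧ l.IsChain G.Adj

theorem IsPathList.reverse {l : List V} (h : IsPathList G l) : IsPathList G l.reverse := by
  refine ⟨List.nodup_reverse.2 h.1, ?_⟩
  rw [List.isChain_reverse]
  exact h.2.imp fun _ _ h => h.symm

theorem IsPathList.infix {l l' : List V} (h : IsPathList G l) (h' : l' <:+: l) :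
    IsPathList G l' :=
  ⟨h'.sublist.nodup h.1, h.2.infix h'⟩

/-- The `P_n`-line graph, extended by isolated vertices to all unordered pairs of vertices. -/
def pairHL (n : ℕ) (G : SimpleGraph V) : SimpleGraph (Sym2 V) where
  Adj e f := ∃ he hf, (HL (SimpleGraph.pathGraph n) G).Adj ⟨e, he⟩ ⟨f, hf⟩
  symm := ⟨fun _ _ ⟨he, hf, h⟩ => ⟨hf, he, h.symm⟩⟩
  loopless := ⟨fun _ ⟨_, _, h⟩ => h.ne rfl⟩

/-- The `P_n`-line graph is an induced subgraph of its extension to all pairs. -/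
def toPairHL (n : ℕ) (G : SimpleGraph V) : HL (SimpleGraph.pathGraph n) G ↪g pairHL n G where
  toFun := Subtype.val
  inj' := Subtype.val_injective
  map_rel_iff' := ⟨fun ⟨_, _, h⟩ => h, fun h => ⟨_, _, h⟩⟩

theorem mem_range_toPairHL {e f : Sym2 V} (h : (pairHL n G).Adj e f) :
    e ∈ Set.range (toPairHL n G) :=
  ⟨⟨e, h.1⟩, rfl⟩

/-- As `3 ≤ n`, any three consecutive vertices of a path with at least `n` vertices lie in a subpath
with exactly `n`. -/
theorem IsPathList.pairHL_adj {l : List V} (hl : IsPathList G l) (hn : 3 ≤ n) (hnl : n ≤ l.length)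
    {u v w : V} (h : [u, v, w] <:+: l) : (pairHL n G).Adj s(u, v) s(v, w) := by
  obtain ⟨s, t, hst⟩ := h
  have hlen : s.length + 3 + t.length = l.length := by simp [← hst]; omega
  -- The window of `n` entries starts at `u`, or, if that would overrun the list, consists of the
  -- last `n` entries.
  obtain ⟨k, hk1, hk2, hk3⟩ : ∃ k, k ≤ s.length ∧ k + n ≤ l.length ∧ s.length + 3 ≤ k + n :=
    ⟨min s.length (l.length - n), by omega, by omega, by omega⟩
  have hadj : ∀ i (hi : i + 1 < l.length), G.Adj l[i] l[i + 1] := fun i hi =>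
    List.isChain_iff_getElem.1 hl.2 i hi
  let f : SimpleGraph.Copy (SimpleGraph.pathGraph n) G :=
    ⟨⟨fun i => l[k + i.1]'(by omega), by
      intro a b hab
      rw [SimpleGraph.pathGraph_adj] at hab
      rcases hab with hab | hab
      · have := hadj (k + a) (by omega)
        simp only [← hab]
        exact this
      · have := (hadj (k + b) (by omega)).symm
        simp only [← hab]
        exact this⟩, by
      intro a b hab
      have : k + a.1 = k + b.1 := (List.Nodup.getElem_inj_iff hl.1).1 hab
      exact Fin.ext (by omega)⟩
  have hf : ∀ i (hi : k ≤ i) (hi' : i < k + n), f ⟨i - k, by omega⟩ = l[i]'(by omega) := by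
    intro i hi hi'
    change l[k + (i - k)]'_ = _
    simp only [Nat.add_sub_cancel' hi]
  have hu : l[s.length]'(by omega) = u := by simp [← hst]
  have hv : l[s.length + 1]'(by omega) = v := by simp [← hst, List.getElem_append_right]
  have hw : l[s.length + 2]'(by omega) = w := by simp [← hst, List.getElem_append_right]
  have huv : f.toSubgraph.Adj u v := by
    refine ⟨⟨s.length - k, by omega⟩, ⟨s.length + 1 - k, by omega⟩, ?_, ?_, ?_⟩
    · simp only [SimpleGraph.Subgraph.top_adj, SimpleGraph.pathGraph_adj]; omega
    · exact (hf s.length hk1 (by omega)).trans hu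
    · exact (hf (s.length + 1) (by omega) (by omega)).trans hv
  have hvw : f.toSubgraph.Adj v w := by
    refine ⟨⟨s.length + 1 - k, by omega⟩, ⟨s.length + 2 - k, by omega⟩, ?_, ?_, ?_⟩
    · simp only [SimpleGraph.Subgraph.top_adj, SimpleGraph.pathGraph_adj]; omega
    · exact (hf (s.length + 1) (by omega) (by omega)).trans hv
    · exact (hf (s.length + 2) (by omega) (by omega)).trans hw
  have huw : u ≠ w := by
    have := hl.1
    rw [← hst] at this
    grind
  refine ⟨huv.adj_sub, hvw.adj_sub, ⟨?_, ?_⟩, f.toSubgraph, ⟨f.isoToSubgraph⟩, huv, hvw⟩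
  · intro h
    have h' : s(u, v) = s(v, w) := congrArg Subtype.val h
    have := huv.ne
    rw [Sym2.eq_iff] at h'
    grind
  · exact ⟨v, by simp⟩

theorem IsPathList.edgeList_isChain {l l' : List V} (hl : IsPathList G l) (hn : 3 ≤ n)
    (hnl : n ≤ l.length) (h : l' <:+: l) : (edgeList l').IsChain (pairHL n G).Adj :=
  HLineGraph.edgeList_isChain fun _ _ _ h' => hl.pairHL_adj hn hnl (h'.trans h)

end PathLists

/-! ### Pulling sequences back along an embedding that misses only isolated vertices -/

section Lifting

variable {α : Type*} {β : Type*} {X : SimpleGraph α} {Y : SimpleGraph β}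

theorem exists_adj_of_isChain {l : List β} {a : β} (h : (l ++ [a]).IsChain Y.Adj) {v : β}
    (hv : v ∈ l) : ∃ b, Y.Adj v b := by
  obtain ⟨s, t, rfl⟩ := List.append_of_mem hv
  have h' : (v :: (t ++ [a])).IsChain Y.Adj := h.suffix ⟨s, by simp⟩
  rcases t with _ | ⟨b, t⟩
  · exact ⟨a, (List.isChain_cons_cons.1 h').1⟩
  · exact ⟨b, (List.isChain_cons_cons.1 h').1⟩

/-- The extra entry `a` ensures that every entry of `l` has a neighbour, hence lies in the range. -/
theorem exists_map_eq_of_isChain (φ : X ↪g Y) (hφ : ∀ a b, Y.Adj a b → a ∈ Set.range φ)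
    {l : List β} {a : β} (h : (l ++ [a]).IsChain Y.Adj) : ∃ l' : List α, l'.map φ = l := by
  have : l ∈ Set.range (List.map φ) := by
    rw [Set.range_list_map]
    intro v hv
    obtain ⟨b, hb⟩ := exists_adj_of_isChain h hv
    exact hφ _ _ hb
  exact this

theorem exists_map_eq_of_isChain_cons (φ : X ↪g Y) (hφ : ∀ a b, Y.Adj a b → a ∈ Set.range φ)
    {l : List β} {a : β} (h : (a :: l).IsChain Y.Adj) : ∃ l' : List α, l'.map φ = l := by
  have h' : (l.reverse ++ [a]).IsChain Y.Adj := by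
    rw [← List.reverse_cons, List.isChain_reverse]
    exact h.imp fun _ _ h => h.symm
  obtain ⟨l', hl'⟩ := exists_map_eq_of_isChain φ hφ h'
  exact ⟨l'.reverse, by rw [List.map_reverse, hl', List.reverse_reverse]⟩

theorem isChain_map_embedding (φ : X ↪g Y) {l : List α} :
    (l.map φ).IsChain Y.Adj ↔ l.IsChain X.Adj := by
  rw [List.isChain_map]
  exact List.IsChain.iff fun _ _ => φ.map_adj_iff

theorem nodup_map_embedding (φ : X ↪g Y) {l : List α} : (l.map φ).Nodup ↔ l.Nodup :=
  List.nodup_map_iff φ.injective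

end Lifting

/-! ### Long cycles with a further edge grow forever -/

section ChordedCycle

variable {V : Type u} {G : SimpleGraph V} {n m : ℕ}

/-- The graph has a cycle `z x … y` of length `m` and an edge at `z` outside of that cycle. -/
def HasChordedCycle (G : SimpleGraph V) (m : ℕ) : Prop :=
  ∃ z x B y w, (z :: x :: B ++ [y]).Nodup ∧ (z :: x :: B ++ [y, z]).IsChain G.Adj ∧
    G.Adj z w ∧ w ≠ x ∧ w ≠ y ∧ B.length + 3 = m

theorem HasChordedCycle.lift {W : Type v} {Y : SimpleGraph W} (φ : G ↪g Y)
    (hφ : ∀ a b, Y.Adj a b → a ∈ Set.range φ) (h : HasChordedCycle Y m) : HasChordedCycle G m := by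
  obtain ⟨z, x, B, y, w, hnd, hch, hzw, hwx, hwy, hm⟩ := h
  obtain ⟨L, hL⟩ := exists_map_eq_of_isChain (l := z :: x :: B ++ [y]) (a := z) φ hφ
    (by simpa using hch)
  obtain ⟨w', rfl⟩ := hφ _ _ hzw.symm
  obtain ⟨z', L, rfl, rfl, h1⟩ := List.map_eq_cons_iff.1 hL
  obtain ⟨x', L, rfl, rfl, h2⟩ := List.map_eq_cons_iff.1 h1
  obtain ⟨B', L, rfl, rfl, h3⟩ := List.map_eq_append_iff.1 h2
  obtain ⟨y', L, rfl, rfl, h4⟩ := List.map_eq_cons_iff.1 h3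
  obtain rfl := List.map_eq_nil_iff.1 h4
  refine ⟨z', x', B', y', w', ?_, ?_, φ.map_adj_iff.1 hzw, ?_, ?_, by simpa using hm⟩
  · rw [← nodup_map_embedding φ]; simpa using hnd
  · rw [← isChain_map_embedding φ]; simpa using hch
  · rintro rfl; exact hwx rfl
  · rintro rfl; exact hwy rfl

/-- The further edge is the chord from `z` to the last vertex but one; `L ≠ []` keeps that vertex
apart from the successor of `z`. -/
theorem hasChordedCycle_of_triangle {z y w : V} {L : List V} (hL : L ≠ [])
    (hnd : (z :: (L ++ [w, y])).Nodup) (hch : (z :: (L ++ [w, y, z])).IsChain G.Adj)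
    (hzw : G.Adj z w) (hm : L.length + 3 = m) : HasChordedCycle G m := by
  obtain ⟨x, B, rfl⟩ := List.exists_cons_of_ne_nil hL
  refine ⟨z, x, B ++ [w], y, w, by simpa using hnd, by simpa using hch, hzw, ?_, ?_, ?_⟩
  · grind
  · grind
  · simp at hm ⊢; omega

theorem eq_of_mem_edgeList_closed {z x y w : V} {B : List V} (hnd : (z :: x :: B ++ [y]).Nodup)
    (h : s(z, w) ∈ edgeList (z :: x :: B ++ [y, z])) : w = x ∨ w = y := by
  rw [show z :: x :: B ++ [y, z] = (z :: x :: B) ++ y :: [z] by simp, edgeList_append] at h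
  simp only [List.cons_append, edgeList_cons_cons, edgeList_singleton, List.mem_cons,
    List.mem_append, List.not_mem_nil, or_false, Sym2.eq_iff] at h
  rcases h with (h | h) | h | h
  · exact Or.inl h.2
  · grind
  · have := mem_of_mem_edgeList h (Sym2.mem_mk_left z w)
    grind
  · grind

/-- Consecutive edges of the cycle are adjacent, because deleting another edge leaves a path with `m
≥ n` vertices. The edge `zw` is adjacent to both cycle edges at `z`. Inserting it between them gives
a cycle of length `m + 1`, with the adjacency of these two as a chord. -/
theorem HasChordedCycle.pairHL_succ (hn : 3 ≤ n) (hnm : n ≤ m) (h : HasChordedCycle G m) :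
    HasChordedCycle (pairHL n G) (m + 1) := by
  classical
  obtain ⟨z, x, B, y, w, hnd, hch, hzw, hwx, hwy, hm⟩ := h
  have hP1 : IsPathList G (z :: x :: B ++ [y]) := ⟨hnd, hch.prefix ⟨[z], by simp⟩⟩
  have hP2 : IsPathList G (x :: B ++ [y, z]) := by
    refine ⟨?_, hch.suffix ⟨[z], by simp⟩⟩
    refine (List.Perm.nodup_iff ?_).1 hnd
    exact List.perm_iff_count.2 fun a => by simp [List.count_cons]; omega
  have hyz : G.Adj y z := by
    have := hch.suffix (l₁ := [y, z]) ⟨z :: x :: B, by simp⟩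
    simpa using this
  have hP3 : IsPathList G (y :: z :: x :: B) := by
    refine ⟨?_, List.isChain_cons_cons.2 ⟨hyz, hP1.2.prefix ⟨[y], by simp⟩⟩⟩
    refine (List.Perm.nodup_iff ?_).1 hnd
    exact List.perm_iff_count.2 fun a => by simp [List.count_cons]; omega
  have hcyc : (edgeList (z :: (x :: B ++ [y]) ++ [z])).IsChain (pairHL n G).Adj := by
    refine edgeList_isChain_overlap (by simp) ?_ ?_
    · exact hP1.edgeList_isChain hn (by simp; omega) List.infix_rfl
    · exact hP2.edgeList_isChain hn (by simp; omega) ⟨[], [], by simp⟩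
  have hxy : (pairHL n G).Adj s(z, x) s(y, z) := by
    have := hP3.pairHL_adj hn (by simp; omega) (u := y) (v := z) (w := x) ⟨[], B, by simp⟩
    exact this.symm
  have hcorner : (pairHL n G).Adj s(z, w) s(z, x) ∧ (pairHL n G).Adj s(y, z) s(z, w) := by
    -- If `w` lies on the cycle, adding the chord and deleting one cycle edge at `z` and a suitable
    -- one at `w` leaves a path through all `m` vertices. Otherwise the cycle minus an edge at `z`
    -- is prolonged by `w`.
    by_cases hw : w ∈ B
    · obtain ⟨B₁, B₂, rfl⟩ := List.append_of_mem hw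
      have h1 : (z :: x :: B₁).IsChain G.Adj := hP1.2.prefix ⟨w :: B₂ ++ [y], by simp⟩
      have h2 : (w :: B₂ ++ [y]).IsChain G.Adj := hP1.2.suffix ⟨z :: x :: B₁, by simp⟩
      have h3 : (x :: B₁ ++ [w]).IsChain G.Adj := hP2.2.prefix ⟨B₂ ++ [y, z], by simp⟩
      have h4 : (B₂ ++ [y, z]).IsChain G.Adj := hP2.2.suffix ⟨x :: B₁ ++ [w], by simp⟩
      constructor
      · have hQ : IsPathList G (((w :: B₂) ++ [y]).reverse ++ z :: x :: B₁) := by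
          refine ⟨?_, ?_⟩
          · refine (List.Perm.nodup_iff ?_).1 hnd
            exact List.perm_iff_count.2 fun a => by simp [List.count_cons]; omega
          · have h2' : ((w :: B₂) ++ [y]).reverse.IsChain G.Adj := by
              rw [List.isChain_reverse]; exact h2.imp fun _ _ h => h.symm
            have := List.isChain_append_cons_cons (l₁ := (B₂ ++ [y]).reverse).2
              ⟨by simpa using h2', hzw.symm, h1⟩
            simpa using this
        rw [Sym2.eq_swap]
        exact hQ.pairHL_adj hn (by simp at hm ⊢; omega) ⟨(B₂ ++ [y]).reverse, B₁, by simp⟩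
      · have hQ : IsPathList G ((B₂ ++ [y, z]) ++ (x :: B₁ ++ [w]).reverse) := by
          refine ⟨?_, ?_⟩
          · refine (List.Perm.nodup_iff ?_).1 hnd
            exact List.perm_iff_count.2 fun a => by simp [List.count_cons]; omega
          · have h3' : (x :: B₁ ++ [w]).reverse.IsChain G.Adj := by
              rw [List.isChain_reverse]; exact h3.imp fun _ _ h => h.symm
            refine h4.append h3' ?_
            simp [hzw]
        exact hQ.pairHL_adj hn (by simp at hm ⊢; omega) ⟨B₂, (x :: B₁).reverse, by simp⟩
    · have hwz : w ≠ z := hzw.ne'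
      have hw' : w ∉ z :: x :: B ++ [y] := by simp [hwz, hwx, hwy, hw]
      have hQ : IsPathList G (w :: z :: x :: B ++ [y]) :=
        ⟨List.nodup_cons.2 ⟨hw', hnd⟩, List.isChain_cons_cons.2 ⟨hzw.symm, hP1.2⟩⟩
      have hQ' : IsPathList G (x :: B ++ [y, z, w]) := by
        refine ⟨?_, ?_⟩
        · refine (List.Perm.nodup_iff ?_).1 hQ.1
          exact List.perm_iff_count.2 fun a => by simp [List.count_cons]; omega
        · have := List.isChain_append_cons_cons (l₁ := x :: B ++ [y]) (b := z) (c := w)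
            (l₂ := []) (R := G.Adj)
          simp only [List.append_assoc, List.cons_append, List.nil_append] at this ⊢
          exact this.2 ⟨by simpa using hP2.2, hzw, by simp⟩
      constructor
      · rw [Sym2.eq_swap]
        exact hQ.pairHL_adj hn (by simp; omega) ⟨[], B ++ [y], by simp⟩
      · exact hQ'.pairHL_adj hn (by simp; omega) ⟨x :: B, [], by simp⟩
  have hsplit : edgeList (z :: (x :: B ++ [y]) ++ [z]) =
      s(z, x) :: (edgeList (x :: B ++ [y]) ++ [s(y, z)]) := by
    have := edgeList_append (z :: x :: B) y [z]
    simpa using this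
  have hnd' := nodup_edgeList_closed (z := z) (l := x :: B ++ [y]) (by simpa using hnd)
    (by simp)
  refine hasChordedCycle_of_triangle (z := s(z, x)) (y := s(z, w)) (w := s(y, z))
    (L := edgeList (x :: B ++ [y])) ?_ ?_ ?_ hxy ?_
  · rw [← List.length_pos_iff]; simp
  · have hmem : s(z, w) ∉ edgeList (z :: (x :: B ++ [y]) ++ [z]) := fun h => by
      rcases eq_of_mem_edgeList_closed hnd (by simpa using h) with h | h
      · exact hwx h
      · exact hwy h
    have : (edgeList (z :: (x :: B ++ [y]) ++ [z]) ++ [s(z, w)]).Nodup := by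
      refine List.Nodup.append hnd' (by simp) ?_
      simpa using hmem
    rw [hsplit] at this
    simpa using this
  · rw [hsplit] at hcyc
    have h1 := List.isChain_append_cons_cons (l₁ := s(z, x) :: edgeList (x :: B ++ [y]))
      (b := s(y, z)) (c := s(z, w)) (l₂ := [s(z, x)]) (R := (pairHL n G).Adj)
    have := h1.2 ⟨by simpa using hcyc, hcorner.2, by simpa using hcorner.1⟩
    simpa using this
  · simp; omega

theorem HasChordedCycle.HL_succ (hn : 3 ≤ n) (hnm : n ≤ m) (h : HasChordedCycle G m) :
    HasChordedCycle (HL (SimpleGraph.pathGraph n) G) (m + 1) :=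
  (h.pairHL_succ hn hnm).lift (toPairHL n G) fun _ _ => mem_range_toPairHL

end ChordedCycle

/-! ### Unbounded growth excludes convergence -/

section Diverges

variable {V : Type u} {n : ℕ}

/-- Some iterated `P_n`-line graph has a cycle of length at least `n` that is incident to a further
edge. -/
def Diverges (n : ℕ) (G : SimpleGraph V) : Prop :=
  ∃ j m, n ≤ m ∧ HasChordedCycle (iterHL (SimpleGraph.pathGraph n) G j).2 m

theorem iterHL_HL {W : Type v} (H : SimpleGraph W) (G : SimpleGraph V) (k : ℕ) :
    iterHL H (HL H G) k = iterHL H G (k + 1) := by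
  induction k with
  | zero => rfl
  | succ k ih =>
    change (⟨_, HL H (iterHL H (HL H G) k).2⟩ : (X : Type u) × SimpleGraph X) = _
    rw [ih]
    rfl

theorem Diverges.of_HL {G : SimpleGraph V} (h : Diverges n (HL (SimpleGraph.pathGraph n) G)) :
    Diverges n G := by
  obtain ⟨j, m, hm, h⟩ := h
  refine ⟨j + 1, m, hm, ?_⟩
  rwa [← iterHL_HL]

theorem HasChordedCycle.diverges {G : SimpleGraph V} {m : ℕ} (hm : n ≤ m)
    (h : HasChordedCycle G m) : Diverges n G :=
  ⟨0, m, hm, h⟩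

theorem exists_hasChordedCycle_iterHL {G : SimpleGraph V} {j m : ℕ} (hn : 3 ≤ n) (hm : n ≤ m)
    (h : HasChordedCycle (iterHL (SimpleGraph.pathGraph n) G j).2 m) (k : ℕ) :
    HasChordedCycle (iterHL (SimpleGraph.pathGraph n) G (j + k)).2 (m + k) := by
  induction k with
  | zero => exact h
  | succ k ih => exact ih.HL_succ hn (Nat.le_add_right_of_le hm)

theorem finite_iterHL {W : Type v} (H : SimpleGraph W) (G : SimpleGraph V) [Finite V] (k : ℕ) :
    Finite (iterHL H G k).1 := by
  induction k with
  | zero => assumption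
  | succ k ih => exact (inferInstance : Finite (iterHL H G k).2.edgeSet)

/-- An isomorphism of graphs induces an isomorphism of their `H`-line graphs. -/
theorem nonempty_HL_iso {W : Type v} (H : SimpleGraph W) {α β : Type u} {X : SimpleGraph α}
    {Y : SimpleGraph β} (φ : X ≃g Y) : Nonempty (HL H X ≃g HL H Y) := by
  have key : ∀ {α β : Type u} {X : SimpleGraph α} {Y : SimpleGraph β} (φ : X ≃g Y)
      (e f : X.edgeSet), (HL H X).Adj e f →
      (HL H Y).Adj (φ.mapEdgeSet e) (φ.mapEdgeSet f) := by
    rintro α β X Y φ e f ⟨⟨hne, hint⟩, K, ⟨ψ⟩, he, hf⟩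
    refine ⟨⟨fun h => hne (φ.mapEdgeSet.injective h), ?_⟩, K.map φ.toHom,
      ⟨ψ.trans ((SimpleGraph.Copy.isoSubgraphMap (φ.toCopy) K))⟩, ?_, ?_⟩
    · obtain ⟨v, hv1, hv2⟩ := hint
      exact ⟨φ v, Sym2.mem_map.2 ⟨v, hv1, rfl⟩, Sym2.mem_map.2 ⟨v, hv2, rfl⟩⟩
    · rw [SimpleGraph.Subgraph.edgeSet_map]
      exact ⟨e, he, rfl⟩
    · rw [SimpleGraph.Subgraph.edgeSet_map]
      exact ⟨f, hf, rfl⟩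
  refine ⟨⟨φ.mapEdgeSet, fun {e f} => ⟨fun h => ?_, key φ e f⟩⟩⟩
  have := key φ.symm _ _ h
  have hs : ∀ e : X.edgeSet, φ.symm.mapEdgeSet (φ.mapEdgeSet e) = e :=
    fun e => φ.mapEdgeSet.symm_apply_apply e
  rwa [hs, hs] at this

theorem Diverges.not_converges [Finite V] {G : SimpleGraph V} (hn : 3 ≤ n) (h : Diverges n G) :
    ¬ Converges (SimpleGraph.pathGraph n) G := by
  rintro ⟨⟨N, ⟨φ⟩⟩, -⟩
  obtain ⟨j, m, hm, h⟩ := h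
  set H := SimpleGraph.pathGraph n
  have hiso : ∀ k, Nonempty ((iterHL H G N).2 ≃g (iterHL H G (N + k)).2) := by
    have hstep : ∀ k, Nonempty ((iterHL H G (N + k)).2 ≃g (iterHL H G (N + k + 1)).2) := by
      intro k
      induction k with
      | zero => exact ⟨φ⟩
      | succ k ih => exact nonempty_HL_iso H ih.some
    intro k
    induction k with
    | zero => exact ⟨SimpleGraph.Iso.refl⟩
    | succ k ih => exact ⟨ih.some.trans (hstep k).some⟩
  have := finite_iterHL H G N
  set c := Nat.card (iterHL H G N).1
  -- All iterates from the `N`-th on have `c` vertices, but this one contains a cycle of length `m +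
  -- N + c`.
  obtain ⟨z, x, B, y, w, hnd, -, -, -, -, hB⟩ :=
    exists_hasChordedCycle_iterHL hn hm h (N + c)
  have hfin := finite_iterHL H G (j + (N + c))
  have hle := Nat.card_congr (hiso (j + c)).some.toEquiv
  rw [show N + (j + c) = j + (N + c) by omega] at hle
  have := Fintype.ofFinite (iterHL H G (j + (N + c))).1
  have h2 := hnd.length_le_card
  rw [← Nat.card_eq_fintype_card, ← hle] at h2
  simp only [List.length_append, List.length_cons, List.length_nil] at h2
  omega

end Diverges

/-! ### A cycle with one arm -/

section Lollipop

variable {V : Type u} {G : SimpleGraph V} {n k : ℕ}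

/-- The graph has a cycle `z :: B` with a path `A` of length `k` attached to `z`, of total size
greater than `n`. -/
def HasLollipop (n : ℕ) (G : SimpleGraph V) (k : ℕ) : Prop :=
  ∃ A z B, (A ++ z :: B).Nodup ∧ (z :: A).IsChain G.Adj ∧ (z :: B ++ [z]).IsChain G.Adj ∧
    2 ≤ B.length ∧ A.length = k ∧ n ≤ A.length + B.length

theorem HasLollipop.lift {W : Type v} {Y : SimpleGraph W} (φ : G ↪g Y)
    (hφ : ∀ a b, Y.Adj a b → a ∈ Set.range φ) (h : HasLollipop n Y k) : HasLollipop n G k := by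
  obtain ⟨A, z, B, hnd, hA, hB, h2, hk, hn⟩ := h
  obtain ⟨A, rfl⟩ := exists_map_eq_of_isChain_cons φ hφ hA
  obtain ⟨L, hL⟩ := exists_map_eq_of_isChain φ hφ hB
  obtain ⟨z, B, rfl, rfl, rfl⟩ := List.map_eq_cons_iff.1 hL
  refine ⟨A, z, B, ?_, ?_, ?_, by simpa using h2, by simpa using hk, by simpa using hn⟩
  · rw [← nodup_map_embedding φ]; simpa using hnd
  · rw [← isChain_map_embedding φ]; simpa using hA
  · rw [← isChain_map_embedding φ]; simpa using hB

theorem HasLollipop.hasChordedCycle (h : HasLollipop n G 1) :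
    ∃ m, n ≤ m ∧ HasChordedCycle G m := by
  obtain ⟨A, z, B, hnd, hA, hB, h2, hk, hn⟩ := h
  obtain ⟨w, rfl⟩ := List.length_eq_one_iff.1 hk
  rcases B with _ | ⟨x, B⟩
  · simp at h2
  rcases List.eq_nil_or_concat B with rfl | ⟨B, y, rfl⟩
  · simp at h2
  rw [List.concat_eq_append] at *
  refine ⟨B.length + 3, ?_, z, x, B, y, w, ?_, ?_, ?_, ?_, ?_, rfl⟩
  · simp at hn; omega
  · simp only [List.cons_append, List.nil_append] at hnd ⊢
    exact (List.nodup_cons.1 hnd).2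
  · simpa using hB
  · simpa using hA
  · grind
  · grind

/-- Let `w` be the first arm vertex. The closed walk `w z B z w` traverses `zw`, the edges of the
cycle, and `zw` again; this is the new cycle, one longer than the old one. The two cycle edges at
`z` need not be adjacent. Each triple of consecutive vertices lies on one of the two paths that pass
through the arm and then around the cycle in either direction. -/
theorem HasLollipop.pairHL (hn : 3 ≤ n) (h : HasLollipop n G (k + 2)) :
    HasLollipop n (pairHL n G) (k + 1) := by
  classical
  obtain ⟨A, z, B, hnd, hA, hB, h2, hk, hnl⟩ := h
  obtain ⟨w, A, rfl⟩ := List.exists_cons_of_ne_nil (l := A) (by rintro rfl; simp at hk)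
  have hzB : (z :: B).Nodup := hnd.sublist (List.sublist_append_right _ _)
  have hrev : ∀ {l : List V}, l.IsChain G.Adj → l.reverse.IsChain G.Adj := fun h => by
    rw [List.isChain_reverse]; exact h.imp fun _ _ h => h.symm
  have hQ1 : IsPathList G (A.reverse ++ w :: z :: B) := by
    constructor
    · refine (List.Perm.nodup_iff ?_).1 hnd
      exact List.perm_iff_count.2 fun a => by simp [List.count_cons]; omega
    · have h1 : ((A.reverse ++ [w]) ++ [z] ++ B).IsChain G.Adj :=
        List.IsChain.append_overlap (by simpa using hrev hA) (hB.prefix ⟨[z], by simp⟩) (by simp)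
      simpa using h1
  have hQ2 : IsPathList G (B ++ z :: w :: A) := by
    constructor
    · refine (List.Perm.nodup_iff ?_).1 hnd
      exact List.perm_iff_count.2 fun a => by simp [List.count_cons]; omega
    · have h1 : (B ++ [z] ++ (w :: A)).IsChain G.Adj :=
        List.IsChain.append_overlap (hB.suffix ⟨[z], by simp⟩) hA (by simp)
      simpa using h1
  have hl1 : n ≤ (A.reverse ++ w :: z :: B).length := by simp at hnl ⊢; omega
  have hl2 : n ≤ (B ++ z :: w :: A).length := by simp at hnl ⊢; omega
  have e1 : (edgeList (w :: (z :: B))).IsChain (HLineGraph.pairHL n G).Adj :=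
    hQ1.edgeList_isChain hn hl1 ⟨A.reverse, [], by simp⟩
  have e2 : (edgeList (B ++ [z])).IsChain (HLineGraph.pairHL n G).Adj :=
    hQ2.edgeList_isChain hn hl2 ⟨[], w :: A, by simp⟩
  have e3 : (edgeList ((B ++ [z]) ++ [w])).IsChain (HLineGraph.pairHL n G).Adj :=
    hQ2.edgeList_isChain hn hl2 ⟨[], A, by simp⟩
  have e4 : (edgeList (z :: B ++ [z])).IsChain (HLineGraph.pairHL n G).Adj :=
    edgeList_isChain_overlap h2 (hQ1.edgeList_isChain hn hl1 ⟨A.reverse ++ [w], [], by simp⟩) e2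
  have e5 : (edgeList (z :: (B ++ [z]) ++ [w])).IsChain (HLineGraph.pairHL n G).Adj :=
    edgeList_isChain_overlap (by simp; omega) e4 e3
  have e6 : (edgeList (w :: (z :: B ++ [z]) ++ [w])).IsChain (HLineGraph.pairHL n G).Adj :=
    edgeList_isChain_overlap (by simp) (edgeList_isChain_overlap (by simp; omega) e1 e4) e5
  have hsplit : edgeList (w :: (z :: B ++ [z]) ++ [w]) =
      s(z, w) :: edgeList (z :: B ++ [z]) ++ [s(z, w)] := by
    have := edgeList_append (w :: z :: B) z [w]
    simpa [Sym2.eq_swap] using this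
  rw [hsplit] at e6
  refine ⟨edgeList (w :: A), s(z, w), edgeList (z :: B ++ [z]), ?_, ?_, e6, ?_, ?_, ?_⟩
  · have hd : ∀ v ∈ w :: A, v ∉ z :: B := fun v hv hv' => by
      exact (List.nodup_append.1 hnd).2.2 v hv v hv' rfl
    have hcl : ∀ v, v ∈ z :: B ++ [z] → v ∈ z :: B := by grind
    rw [List.nodup_append]
    refine ⟨nodup_edgeList (hnd.sublist (List.sublist_append_left _ _)),
      List.nodup_cons.2 ⟨fun h => ?_, nodup_edgeList_closed hzB h2⟩, ?_⟩
    · exact hd w (by simp) (hcl _ (mem_of_mem_edgeList h (Sym2.mem_mk_right z w)))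
    · rintro e he f hf rfl
      rcases List.mem_cons.1 hf with rfl | hf
      · exact hd z (mem_of_mem_edgeList he (Sym2.mem_mk_left z w)) (by simp)
      · induction e using Sym2.ind with
        | _ a b =>
        exact hd a (mem_of_mem_edgeList he (Sym2.mem_mk_left a b))
          (hcl _ (mem_of_mem_edgeList hf (Sym2.mem_mk_left a b)))
  · have : (edgeList (z :: w :: A)).IsChain (HLineGraph.pairHL n G).Adj :=
      hQ2.edgeList_isChain hn hl2 ⟨B, [], by simp⟩
    simpa using this
  · simp; omega
  · simp at hk ⊢; omega
  · simp at hnl ⊢; omega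

theorem HasLollipop.diverges (hn : 3 ≤ n) :
    ∀ (k : ℕ) {V : Type u} {G : SimpleGraph V}, HasLollipop n G (k + 1) → Diverges n G
  | 0, _, _, h => by
    obtain ⟨m, hm, h⟩ := h.hasChordedCycle
    exact h.diverges hm
  | k + 1, _, G, h =>
    Diverges.of_HL (HasLollipop.diverges hn k
      ((h.pairHL hn).lift (toPairHL n G) fun _ _ => mem_range_toPairHL))

end Lollipop

/-! ### Cyclic concatenation of blocks -/

section RingList

variable {ι : Type} {α : Type*} {β : Type*} (σ : ι → ι) (z : ι → α) (B : ι → List α)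

/-- The concatenation of the blocks `z j :: B j`, where `j` runs through the first `k` iterates
of `i` under `σ`. -/
def ringList : ι → ℕ → List α
  | _, 0 => []
  | i, k + 1 => z i :: B i ++ ringList (σ i) k

theorem ringList_succ' (i : ι) (k : ℕ) :
    ringList σ z B i (k + 1) = ringList σ z B i k ++ z (σ^[k] i) :: B (σ^[k] i) := by
  induction k generalizing i with
  | zero => simp [ringList]
  | succ k ih => rw [ringList, ih (σ i)]; simp [ringList]

/-- Exposes `z i` as the head also for `k = 0`, where it is the appended entry; the gluing of chains
needs this form. -/
theorem exists_ringList_append (i : ι) (k : ℕ) :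
    ∃ t, ∀ l, ringList σ z B i k ++ z (σ^[k] i) :: l = z i :: (t ++ l) := by
  cases k with
  | zero => exact ⟨[], fun l => rfl⟩
  | succ k => exact ⟨B i ++ ringList σ z B (σ i) k ++ [z (σ^[k + 1] i)], by simp [ringList]⟩

theorem isChain_ringList {R : α → α → Prop} {σ : ι → ι} {z : ι → α} {B : ι → List α}
    (h : ∀ i, (z i :: B i ++ [z (σ i)]).IsChain R) (i : ι) (k : ℕ) :
    (ringList σ z B i k ++ [z (σ^[k] i)]).IsChain R := by
  induction k generalizing i with
  | zero => simp [ringList]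
  | succ k ih =>
    obtain ⟨t, ht⟩ := exists_ringList_append σ z B (σ i) k
    have h1 := ih (σ i)
    rw [ht] at h1
    have h2 := (List.isChain_split (R := R) (c := z (σ i)) (l₁ := z i :: B i) (l₂ := t ++ [])).2
      ⟨h i, h1⟩
    rw [← ht] at h2
    simpa [ringList] using h2

theorem length_ringList {d : ℕ} {B : ι → List α} (h : ∀ i, (B i).length + 1 = d) (i : ι) (k : ℕ) :
    (ringList σ z B i k).length = k * d := by
  induction k generalizing i with
  | zero => simp [ringList]
  | succ k ih =>
    simp only [ringList, List.length_append, List.length_cons, ih, h, Nat.succ_mul]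
    omega

variable {σ z B}

theorem mem_ringList {i : ι} {k : ℕ} {v : α} (h : v ∈ ringList σ z B i k) :
    ∃ j, v = z j ∨ v ∈ B j := by
  induction k generalizing i with
  | zero => simp [ringList] at h
  | succ k ih =>
    rw [ringList, List.mem_append, List.mem_cons] at h
    rcases h with h | h
    · exact ⟨i, h⟩
    · exact ih h

theorem ringList_map (f : α → β) (i : ι) (k : ℕ) :
    ringList σ (fun j => f (z j)) (fun j => (B j).map f) i k = (ringList σ z B i k).map f := by
  induction k generalizing i with
  | zero => simp [ringList]
  | succ k ih => simp [ringList, ih]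

/-- In the next ring the spokes `y j` alternate with the edges of the arcs. Up to order they
separate, so distinctness can be checked on each kind alone. -/
theorem edgeList_ringList_perm (y : ι → Sym2 α) (i : ι) (k : ℕ) :
    (ringList σ y (fun j => edgeList (z j :: B j ++ [z (σ j)])) i k).Perm
      (ringList σ y (fun _ => []) i k ++ edgeList (ringList σ z B i k ++ [z (σ^[k] i)])) := by
  induction k generalizing i with
  | zero => simp [ringList]
  | succ k ih =>
    obtain ⟨t, ht⟩ := exists_ringList_append σ z B (σ i) k
    have h1 : edgeList (ringList σ z B i (k + 1) ++ [z (σ^[k + 1] i)]) =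
        edgeList (z i :: B i ++ [z (σ i)]) ++
          edgeList (ringList σ z B (σ i) k ++ [z (σ^[k] (σ i))]) := by
      rw [ht, ← edgeList_append, ← ht]
      simp [ringList]
    rw [h1]
    simp only [ringList, List.cons_append, List.nil_append]
    refine List.Perm.cons _ (((ih (σ i)).append_left _).trans ?_)
    rw [← List.append_assoc, ← List.append_assoc]
    exact List.perm_append_comm.append_right _

theorem exists_mem_ringList_nil {y : ι → β} {i : ι} {k : ℕ} {v : β}
    (h : v ∈ ringList σ y (fun _ => []) i k) : ∃ j, v = y j ∧ z j ∈ ringList σ z B i k := by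
  induction k generalizing i with
  | zero => simp [ringList] at h
  | succ k ih =>
    simp only [ringList, List.cons_append, List.nil_append, List.mem_cons] at h
    rcases h with h | h
    · exact ⟨i, h, by simp [ringList]⟩
    · obtain ⟨j, hj, hj'⟩ := ih h
      exact ⟨j, hj, List.mem_append_right _ hj'⟩

theorem nodup_ringList_nil {y : ι → β} (hy : ∀ i j, y i = y j → z i = z j) {i : ι} {k : ℕ}
    (h : (ringList σ z B i k).Nodup) : (ringList σ y (fun _ => []) i k).Nodup := by
  induction k generalizing i with
  | zero => simp [ringList]
  | succ k ih =>
    simp only [ringList, List.cons_append, List.nil_append, List.nodup_cons] at h ⊢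
    refine ⟨fun hm => ?_, ih (h.2.sublist (List.sublist_append_right _ _))⟩
    obtain ⟨j, hj, hj'⟩ := exists_mem_ringList_nil (z := z) (B := B) hm
    exact h.1 (List.mem_append_right _ (hy i j hj ▸ hj'))

end RingList

/-! ### A cycle with several arms -/

section Ring

variable {V : Type u} {G : SimpleGraph V} {n p d : ℕ} {ι : Type} {σ : ι → ι} {z : ι → V}
  {A B : ι → List V}

/-- A cycle of `p + 3` arcs of length `d` each, with a path `A i` (an arm) attached to the initial
vertex `z i` of every arc such that consecutive arms are disjoint and, together with the longer part
of the cycle between them, have at least `n` vertices. -/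
structure IsRing (n p d : ℕ) (G : SimpleGraph V) (σ : ι → ι) (z : ι → V) (A B : ι → List V) :
    Prop where
  iter : ∀ i, σ^[p + 3] i = i
  nodup : ∀ i, (ringList σ z B i (p + 3)).Nodup
  arc : ∀ i, (z i :: B i ++ [z (σ i)]).IsChain G.Adj
  arm : ∀ i, (z i :: A i).IsChain G.Adj
  arm_nodup : ∀ i, (A i).Nodup
  off : ∀ i j, ∀ v ∈ A i, v ≠ z j ∧ v ∉ B j
  disj : ∀ i, (A i).Disjoint (A (σ i))
  len : ∀ i, (B i).length + 1 = d
  long : ∀ i, n ≤ (A i).length + (A (σ i)).length + (p + 2) * d + 1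

theorem IsRing.exists_eq (h : IsRing n p d G σ z A B) (j : ι) : ∃ i, σ i = j :=
  ⟨σ^[p + 2] j, (Function.iterate_succ_apply' σ (p + 2) j).symm.trans (h.iter j)⟩

theorem IsRing.not_mem (h : IsRing n p d G σ z A B) {i j : ι} {k : ℕ} {v : V} (hv : v ∈ A i) :
    v ∉ ringList σ z B j k := fun hv' => by
  obtain ⟨l, hl⟩ := mem_ringList hv'
  exact hl.elim (h.off i l v hv).1 (h.off i l v hv).2

/-- The path comes in along the arm at `z (σ i)`, takes the long way around the cycle, omitting the
arc `i`, and leaves along the arm at `z i`. Only two consecutive arms occur, so no other arms need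
be disjoint. -/
theorem IsRing.isPathList (h : IsRing n p d G σ z A B) (i : ι) :
    IsPathList G ((A (σ i)).reverse ++ (ringList σ z B (σ i) (p + 2) ++ z i :: A i)) := by
  have hi : σ^[p + 2] (σ i) = i := h.iter i
  constructor
  · have h1 := h.nodup (σ i)
    rw [ringList_succ', hi] at h1
    have h2 : (ringList σ z B (σ i) (p + 2) ++ [z i]).Nodup :=
      h1.sublist ((List.Sublist.refl _).append (by simp))
    have h3 : (ringList σ z B (σ i) (p + 2) ++ z i :: A i).Nodup := by
      rw [List.append_cons]
      refine List.Nodup.append h2 (h.arm_nodup i) fun v hv hv' => ?_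
      rcases List.mem_append.1 hv with hv | hv
      · exact h.not_mem hv' hv
      · exact (h.off i i v hv').1 (by simpa using hv)
    refine List.Nodup.append (List.nodup_reverse.2 (h.arm_nodup _)) h3 fun v hv hv' => ?_
    rw [List.mem_reverse] at hv
    rcases List.mem_append.1 hv' with hv' | hv'
    · exact h.not_mem hv hv'
    · rcases List.mem_cons.1 hv' with hv' | hv'
      · exact (h.off _ i v hv).1 hv'
      · exact h.disj i hv' hv
  · have h1 := isChain_ringList h.arc (σ i) (p + 2)
    have h2 : ((A (σ i)).reverse ++ [z (σ i)]).IsChain G.Adj := by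
      rw [← List.reverse_cons, List.isChain_reverse]
      exact (h.arm (σ i)).imp fun _ _ h => h.symm
    have h3 : (ringList σ z B (σ i) (p + 2) ++ z i :: A i).IsChain G.Adj := by
      rw [hi] at h1
      exact List.isChain_split.2 ⟨h1, h.arm i⟩
    obtain ⟨t, ht⟩ := exists_ringList_append σ z B (σ i) (p + 2)
    rw [hi] at ht
    rw [ht] at h3 ⊢
    exact List.isChain_split.2 ⟨h2, h3⟩

theorem IsRing.le_length (h : IsRing n p d G σ z A B) (i : ι) :
    n ≤ ((A (σ i)).reverse ++ (ringList σ z B (σ i) (p + 2) ++ z i :: A i)).length := by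
  have := h.long i
  simp only [List.length_append, List.length_reverse, List.length_cons,
    length_ringList σ z h.len]
  omega

variable {x : ι → V}

/-- There are at least three arcs, so two consecutive ones lie on the path that omits the next. -/
theorem IsRing.corner_isChain (h : IsRing n p d G σ z A B) (hn : 3 ≤ n) (i : ι) :
    (edgeList (z i :: B i ++ z (σ i) :: B (σ i) ++ [z (σ (σ i))])).IsChain (pairHL n G).Adj := by
  refine (h.isPathList (σ (σ i))).edgeList_isChain hn (h.le_length _) ?_
  have hi : σ^[p] (σ (σ (σ i))) = i := h.iter i
  have hi' : σ^[p + 1] (σ (σ (σ i))) = σ i := h.iter (σ i)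
  rw [ringList_succ', ringList_succ', hi, hi']
  exact ⟨(A (σ (σ (σ i)))).reverse ++ ringList σ z B (σ (σ (σ i))) p, A (σ (σ i)), by simp⟩

/-- The spoke at the start and the arc lie on the path omitting the preceding arc; the arc and the
spoke at its end lie on the one omitting the following arc. -/
theorem IsRing.arc_isChain (h : IsRing n p d G σ z (fun i => x i :: A i) B) (hn : 3 ≤ n) (j : ι) :
    (edgeList (x j :: (z j :: B j ++ [z (σ j)]) ++ [x (σ j)])).IsChain (pairHL n G).Adj := by
  refine edgeList_isChain_overlap (by simp) ?_ ?_
  · obtain ⟨i, rfl⟩ := h.exists_eq j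
    refine (h.isPathList i).edgeList_isChain hn (h.le_length _) ?_
    exact ⟨(A (σ i)).reverse,
      B (σ (σ i)) ++ ringList σ z B (σ (σ (σ i))) p ++ z i :: x i :: A i, by simp [ringList]⟩
  · refine (h.isPathList (σ j)).edgeList_isChain hn (h.le_length _) ?_
    have hj : σ^[p + 1] (σ (σ j)) = j := h.iter j
    rw [ringList_succ', hj]
    exact ⟨(x (σ (σ j)) :: A (σ (σ j))).reverse ++ ringList σ z B (σ (σ j)) (p + 1), A (σ j),
      by simp⟩

theorem edgeList_arc (x : ι → V) (j : ι) :
    edgeList (x j :: (z j :: B j ++ [z (σ j)]) ++ [x (σ j)]) =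
      s(z j, x j) :: edgeList (z j :: B j ++ [z (σ j)]) ++ [s(z (σ j), x (σ j))] := by
  have := edgeList_append (x j :: z j :: B j) (z (σ j)) [x (σ j)]
  simpa [Sym2.eq_swap] using this

/-- The spokes become the new corners. Two arms lose one vertex each while `p + 2` arcs gain one
each, so the bound `long` survives because `p ≥ 0`. -/
theorem IsRing.pairHL (h : IsRing n p d G σ z (fun i => x i :: A i) B) (hn : 3 ≤ n) (hd : 1 ≤ d) :
    IsRing n p (d + 1) (pairHL n G) σ (fun i => s(z i, x i)) (fun i => edgeList (x i :: A i))
      (fun i => edgeList (z i :: B i ++ [z (σ i)])) where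
  iter := h.iter
  nodup i := by
    have hcl : ∀ v ∈ ringList σ z B i (p + 3) ++ [z (σ^[p + 3] i)],
        v ∈ ringList σ z B i (p + 3) := by
      intro v hv
      rw [h.iter] at hv
      rcases List.mem_append.1 hv with hv | hv
      · exact hv
      · simp [ringList, List.mem_singleton.1 hv]
    refine (edgeList_ringList_perm _ i (p + 3)).nodup_iff.2 (List.Nodup.append ?_ ?_ ?_)
    · refine nodup_ringList_nil (fun i j hij => ?_) (h.nodup i)
      rw [Sym2.eq_iff] at hij
      rcases hij with hij | hij
      · exact hij.1
      · exact absurd hij.1.symm (h.off j i (x j) (by simp)).1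
    · have h1 := length_ringList σ z h.len i (p + 3)
      have h2 := h.nodup i
      rw [h.iter]
      rw [ringList] at h1 h2 ⊢
      refine nodup_edgeList_closed h2 ?_
      have : (p + 3) * 1 ≤ (p + 3) * d := Nat.mul_le_mul_left _ hd
      simp only [List.cons_append, List.length_cons] at h1
      simp only [List.append_eq]
      omega
    · intro e he he'
      obtain ⟨j, rfl, -⟩ := exists_mem_ringList_nil (z := z) (B := B) he
      have := hcl _ (mem_of_mem_edgeList he' (Sym2.mem_mk_right _ _))
      exact h.not_mem (i := j) (by simp) this
  arc j := by
    have := h.arc_isChain hn j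
    rwa [edgeList_arc] at this
  arm i := by
    have := (h.isPathList i).edgeList_isChain hn (h.le_length _) (l' := z i :: x i :: A i)
      (List.IsSuffix.isInfix ⟨_, by rw [← List.append_assoc]⟩)
    simpa using this
  arm_nodup i := nodup_edgeList (h.arm_nodup i)
  off i j e he := by
    constructor
    · rintro rfl
      exact (h.off i j _ (mem_of_mem_edgeList he (Sym2.mem_mk_left _ _))).1 rfl
    · intro he'
      induction e using Sym2.ind with
      | _ a b =>
      have h1 := mem_of_mem_edgeList he (Sym2.mem_mk_left a b)
      have h2 := mem_of_mem_edgeList he' (Sym2.mem_mk_left a b)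
      have h3 := h.off i j a h1
      have h4 := h.off i (σ j) a h1
      simp only [List.cons_append, List.mem_cons, List.mem_append, List.not_mem_nil,
        or_false] at h2
      tauto
  disj i e he he' := by
    induction e using Sym2.ind with
    | _ a b =>
    exact h.disj i (mem_of_mem_edgeList he (Sym2.mem_mk_left a b))
      (mem_of_mem_edgeList he' (Sym2.mem_mk_left a b))
  len i := by
    have := h.len i
    simp only [length_edgeList, List.cons_append, List.length_cons, List.length_append,
      List.length_nil]
    omega
  long i := by
    have := h.long i
    simp only [length_edgeList, List.length_cons, Nat.mul_add] at this ⊢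
    omega

/-- At an old corner the spoke and the two cycle edges form a triangle, and the adjacency of the
cycle edges is a chord of the new cycle. -/
theorem IsRing.hasChordedCycle_pairHL (h : IsRing n p d G σ z (fun i => x i :: A i) B)
    (hn : 3 ≤ n) (hd : 1 ≤ d) (i : ι) :
    HasChordedCycle (HLineGraph.pairHL n G) ((p + 3) * (d + 1)) := by
  have h' := h.pairHL hn hd
  have hi : σ^[p + 1] (σ (σ i)) = i := h.iter i
  obtain ⟨L, f, hL⟩ : ∃ L f, edgeList (z i :: B i ++ [z (σ i)]) = L ++ [f] := by
    rcases List.eq_nil_or_concat (edgeList (z i :: B i ++ [z (σ i)])) with h | ⟨L, f, h⟩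
    · have := congrArg List.length h; simp at this
    · exact ⟨L, f, by simpa using h⟩
  obtain ⟨f', L', hL'⟩ : ∃ f' L', edgeList (z (σ i) :: B (σ i) ++ [z (σ (σ i))]) = f' :: L' := by
    refine List.exists_cons_of_ne_nil fun h => ?_
    have := congrArg List.length h; simp at this
  have hff : (HLineGraph.pairHL n G).Adj f' f := by
    have h1 := h.corner_isChain hn i
    have h2 := edgeList_append (z i :: B i) (z (σ i)) (B (σ i) ++ [z (σ (σ i))])
    simp only [List.cons_append, List.append_assoc] at h1 h2 hL hL'
    rw [h2, hL, hL'] at h1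
    have h3 : [f, f'].IsChain (HLineGraph.pairHL n G).Adj := h1.infix ⟨L, L', by simp⟩
    exact (List.isChain_pair.1 h3).symm
  have hnd := h'.nodup (σ i)
  have hch := isChain_ringList h'.arc (σ i) (p + 3)
  have hlen := length_ringList σ (fun i => s(z i, x i)) h'.len (σ i) (p + 3)
  rw [h'.iter] at hch
  rw [ringList, ringList_succ', hi, hL, hL'] at hnd hch hlen
  refine hasChordedCycle_of_triangle (z := f') (y := s(z (σ i), x (σ i))) (w := f)
    (L := L' ++ ringList σ (fun i => s(z i, x i)) (fun i => edgeList (z i :: B i ++ [z (σ i)]))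
      (σ (σ i)) (p + 1) ++ s(z i, x i) :: L) (by simp) ?_ ?_ hff ?_
  · refine (List.Perm.nodup_iff ?_).1 hnd
    classical
    exact List.perm_iff_count.2 fun a => by simp [List.count_cons]; omega
  · set M := ringList σ (fun i => s(z i, x i)) (fun i => edgeList (z i :: B i ++ [z (σ i)]))
      (σ (σ i)) (p + 1)
    have h1 : (HLineGraph.pairHL n G).Adj s(z (σ i), x (σ i)) f' := by
      have : [s(z (σ i), x (σ i)), f'].IsChain (HLineGraph.pairHL n G).Adj :=
        hch.infix ⟨[], L' ++ M ++ s(z i, x i) :: L ++ [f, s(z (σ i), x (σ i))], by simp⟩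
      exact List.isChain_pair.1 this
    have h2 : (f' :: (L' ++ M ++ s(z i, x i) :: L ++ [f]) ++ [s(z (σ i), x (σ i))]).IsChain
        (HLineGraph.pairHL n G).Adj := hch.suffix ⟨[s(z (σ i), x (σ i))], by simp⟩
    have h3 := List.isChain_append_cons_cons
      (l₁ := f' :: (L' ++ M ++ s(z i, x i) :: L ++ [f])).2
      ⟨h2, h1, List.isChain_singleton _⟩
    simpa using h3
  · simp only [List.length_append, List.length_cons, List.length_nil] at hlen ⊢
    omega

theorem IsRing.lift {W : Type v} {Y : SimpleGraph W} {z : ι → W} {A B : ι → List W} (φ : G ↪g Y)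
    (hφ : ∀ a b, Y.Adj a b → a ∈ Set.range φ) (h : IsRing n p d Y σ z A B) :
    ∃ z' A' B', IsRing n p d G σ z' A' B' ∧ ∀ i, (A' i).length = (A i).length := by
  have h1 : ∀ i, ∃ a, φ a = z i := fun i => by
    obtain ⟨b, hb⟩ := exists_adj_of_isChain (h.arc i) (v := z i) (by simp)
    exact hφ _ _ hb
  choose z' hz' using h1
  choose A' hA' using fun i => exists_map_eq_of_isChain_cons φ hφ (h.arm i)
  have h2 : ∀ i, ∃ b : List V, b.map φ = B i := fun i => by
    refine exists_map_eq_of_isChain_cons φ hφ (a := z i) ?_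
    exact (h.arc i).prefix ⟨_, rfl⟩
  choose B' hB' using h2
  obtain rfl : (fun i => φ (z' i)) = z := funext hz'
  obtain rfl : (fun i => (A' i).map φ) = A := funext hA'
  obtain rfl : (fun i => (B' i).map φ) = B := funext hB'
  refine ⟨z', A', B', ⟨h.iter, fun i => ?_, fun i => ?_, fun i => ?_, fun i => ?_,
    fun i j v hv => ?_, fun i v hv hv' => ?_, fun i => ?_, fun i => ?_⟩, by simp⟩
  · have := h.nodup i
    rwa [ringList_map, nodup_map_embedding] at this
  · rw [← isChain_map_embedding φ]; simpa using h.arc i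
  · rw [← isChain_map_embedding φ]; simpa using h.arm i
  · rw [← nodup_map_embedding φ]; exact h.arm_nodup i
  · have := h.off i j (φ v) (List.mem_map_of_mem hv)
    exact ⟨fun hv' => this.1 (congrArg φ hv'), fun hv' => this.2 (List.mem_map_of_mem hv')⟩
  · exact h.disj i (List.mem_map_of_mem hv) (List.mem_map_of_mem hv')
  · simpa using h.len i
  · simpa using h.long i

/-- Only one arm is kept. The size suffices since `(p + 3) * d - 1` is at least `(p + 2) * d + 1`
for `d ≥ 2`. -/
theorem IsRing.hasLollipop (h : IsRing n p d G σ z A B) (hd : 2 ≤ d) {i : ι} (hi : A i = []) :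
    HasLollipop n G (A (σ i)).length := by
  have h1 := h.nodup (σ i)
  have h2 := isChain_ringList h.arc (σ i) (p + 3)
  have h3 := length_ringList σ z h.len (σ i) (p + 3)
  rw [h.iter] at h2
  refine ⟨A (σ i), z (σ i), B (σ i) ++ ringList σ z B (σ (σ i)) (p + 2), ?_, h.arm _, h2, ?_, rfl,
    ?_⟩
  · refine List.Nodup.append (h.arm_nodup _) h1 fun v hv hv' => ?_
    exact h.not_mem hv (j := σ i) (k := p + 3) (by rw [ringList]; exact hv')
  · have : (p + 3) * 2 ≤ (p + 3) * d := Nat.mul_le_mul_left _ hd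
    rw [ringList] at h3
    simp only [List.cons_append, List.length_cons] at h3
    omega
  · have := h.long i
    rw [ringList] at h3
    simp only [List.cons_append, List.length_cons, Nat.add_mul] at h3 this
    simp only [hi, List.length_nil] at this
    omega

/-- All arms shrink by one in each step, so the length of any fixed arm bounds the number of steps
until some arm is empty. -/
theorem IsRing.diverges (hn : 3 ≤ n) (i₀ : ι) :
    ∀ (N : ℕ) {V : Type u} {G : SimpleGraph V} {d : ℕ} {z : ι → V} {A B : ι → List V},
      IsRing n p d G σ z A B → 1 ≤ d → (∀ i, A i ≠ []) → (A i₀).length = N → Diverges n G := by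
  intro N
  induction N with
  | zero =>
    intro V G d z A B _ _ hA h0
    exact absurd (List.length_eq_zero_iff.1 h0) (hA i₀)
  | succ N ih =>
    intro V G d z A B h hd hA h0
    choose x A' hA' using fun i => List.exists_cons_of_ne_nil (hA i)
    obtain rfl : A = fun i => x i :: A' i := funext hA'
    refine Diverges.of_HL ?_
    have hc := (h.hasChordedCycle_pairHL hn hd i₀).lift (toPairHL n G)
      fun _ _ => mem_range_toPairHL
    obtain ⟨z', A'', B', h', hlen⟩ := (h.pairHL hn hd).lift (toPairHL n G)
      fun _ _ => mem_range_toPairHL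
    by_cases hall : ∀ i, A'' i ≠ []
    · refine ih h' (by omega) hall ?_
      rw [hlen]
      simp at h0 ⊢
      exact h0
    · push Not at hall
      obtain ⟨i, hi⟩ := hall
      obtain hl | ⟨k, hk⟩ : (A'' (σ i)).length = 0 ∨ ∃ k, (A'' (σ i)).length = k + 1 := by
        cases (A'' (σ i)).length <;> simp
      -- With two consecutive arms empty, `long` gives `n ≤ (p + 2) * (d + 1) + 1`, at most the
      -- length of the chorded cycle.
      · refine hc.diverges ?_
        have := h'.long i
        rw [hl, hi] at this
        simp only [List.length_nil, Nat.add_mul] at this ⊢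
        omega
      · have := h'.hasLollipop (by omega) hi
        rw [hk] at this
        exact HasLollipop.diverges hn k this

end Ring

/-! ### Cycles as vertex sequences -/

section CycleLists

variable {V : Type u} {G : SimpleGraph V}

theorem edges_eq_edgeList {u v : V} (p : G.Walk u v) : p.edges = edgeList p.support := by
  induction p with
  | nil => rfl
  | cons h p ih =>
    rw [SimpleGraph.Walk.edges_cons, ih, SimpleGraph.Walk.support_cons, ← p.cons_tail_support]
    rfl

theorem exists_walk_support_eq {b z : V} {l : List V} (h : (b :: l ++ [z]).IsChain G.Adj) :
    ∃ p : G.Walk b z, p.support = b :: l ++ [z] := by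
  induction l generalizing b with
  | nil =>
    have : G.Adj b z := by simpa using h
    exact ⟨.cons this .nil, rfl⟩
  | cons c l ih =>
    simp only [List.cons_append, List.isChain_cons_cons] at h
    obtain ⟨p, hp⟩ := ih (by simpa using h.2)
    exact ⟨.cons h.1 p, by simp [hp]⟩

theorem exists_isCycleSubgraph {z : V} {l : List V} (hnd : (z :: l).Nodup)
    (hch : (z :: l ++ [z]).IsChain G.Adj) (hl : 2 ≤ l.length) :
    ∃ C : G.Subgraph, IsCycleSubgraph C ∧
      ∀ a b, s(a, b) ∈ edgeList (z :: l ++ [z]) → C.Adj a b := by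
  obtain ⟨b, l, rfl⟩ := List.exists_cons_of_ne_nil (l := l) (by rintro rfl; simp at hl)
  have h1 := nodup_edgeList_closed hnd hl
  simp only [List.cons_append, List.isChain_cons_cons] at hch
  obtain ⟨p, hp⟩ := exists_walk_support_eq (l := l) (b := b) (z := z) (by simpa using hch.2)
  refine ⟨(SimpleGraph.Walk.cons hch.1 p).toSubgraph, ⟨z, _, ?_, rfl⟩, fun a c h => ?_⟩
  · rw [SimpleGraph.Walk.cons_isCycle_iff]
    constructor
    · refine SimpleGraph.Walk.IsPath.mk' ?_
      rw [hp]
      exact (List.perm_append_singleton z (b :: l)).nodup_iff.2 hnd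
    · rw [edges_eq_edgeList, hp]
      simp only [List.cons_append, edgeList_cons_cons, List.nodup_cons] at h1
      exact h1.1
  · rw [← SimpleGraph.Subgraph.mem_edgeSet, SimpleGraph.Walk.mem_edges_toSubgraph,
      edges_eq_edgeList, SimpleGraph.Walk.support_cons, hp]
    exact h

theorem exists_cycle_list {v u : V} {p : G.Walk v v} (hp : p.IsCycle) (hu : u ∈ p.support) :
    ∃ l, (u :: l).Nodup ∧ (u :: l ++ [u]).IsChain G.Adj ∧ l.length + 1 = p.length ∧
      ∀ w, w ∈ u :: l ↔ w ∈ p.support := by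
  classical
  have hq := hp.rotate hu
  have hmem := fun w => p.mem_support_rotate_iff u hu (w := w)
  have hlen := p.length_rotate u hu
  generalize p.rotate u hu = q at *
  cases q with
  | nil => exact absurd rfl hq.ne_nil
  | @cons _ b _ h q =>
    have hne : q.support ≠ [] := q.support_ne_nil
    have hlast : q.support.dropLast ++ [u] = q.support := by
      conv_rhs => rw [← List.dropLast_append_getLast hne, q.getLast_support]
    have hnd : q.support.Nodup := by simpa using hq.support_nodup
    refine ⟨q.support.dropLast, ?_, ?_, ?_, fun w => ?_⟩
    · rw [← hlast] at hnd
      exact (List.perm_append_singleton u _).nodup_iff.1 hnd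
    · have := (SimpleGraph.Walk.cons h q).isChain_adj_support
      rwa [SimpleGraph.Walk.support_cons, ← hlast] at this
    · rw [← hlen, SimpleGraph.Walk.length_cons, List.length_dropLast,
        SimpleGraph.Walk.length_support]
      rfl
    · have h5 : w ∈ q.support ↔ w ∈ q.support.dropLast ∨ w = u := by
        conv_lhs => rw [← hlast, List.mem_append, List.mem_singleton]
      rw [← hmem, SimpleGraph.Walk.support_cons, List.mem_cons, List.mem_cons, h5]
      tauto

end CycleLists

/-! ### Paths leaving a fixed vertex -/

section Legs

variable {V : Type u} {G : SimpleGraph V} {n : ℕ} {r : V}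

theorem exists_first_mem {l₁ l₂ : List V} (h : ¬ l₁.Disjoint l₂) :
    ∃ s t s', l₁ = s ++ t :: s' ∧ t ∈ l₂ ∧ s.Disjoint l₂ := by
  induction l₁ with
  | nil => simp at h
  | cons a l ih =>
    by_cases ha : a ∈ l₂
    · exact ⟨[], a, l, rfl, ha, by simp⟩
    · obtain ⟨s, t, s', rfl, ht, hs⟩ := ih fun h' => h (by simp [ha, h'])
      exact ⟨a :: s, t, s', rfl, ht, by simp [ha, hs]⟩

/-- Two paths that leave `r` along different edges and meet again create a cycle through these
edges. -/
theorem exists_cycle_of_not_disjoint {u v : V} {L₁ L₂ : List V} (huv : u ≠ v)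
    (h₁ : IsPathList G (r :: u :: L₁)) (h₂ : IsPathList G (r :: v :: L₂))
    (h : ¬ (u :: L₁).Disjoint (v :: L₂)) :
    ∃ C : G.Subgraph, IsCycleSubgraph C ∧ C.Adj r u ∧ C.Adj r v := by
  -- The cycle follows the first path up to its first vertex `t` on the second, and returns to `r`
  -- along the second.
  obtain ⟨s, t, s', hs, ht, hd⟩ := exists_first_mem h
  obtain ⟨q, q', hq⟩ := List.append_of_mem ht
  have hrev : ∀ {l : List V}, l.IsChain G.Adj → l.reverse.IsChain G.Adj := fun h => by
    rw [List.isChain_reverse]; exact h.imp fun _ _ h => h.symm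
  rw [hs] at h₁
  rw [hq] at h₂ hd
  have c1 : (r :: s ++ [t]).IsChain G.Adj := h₁.2.prefix ⟨s', by simp⟩
  have c2 : (t :: q.reverse ++ [r]).IsChain G.Adj := by
    have : (r :: q ++ [t]).IsChain G.Adj := h₂.2.prefix ⟨q', by simp⟩
    simpa using hrev this
  have c3 : (r :: (s ++ t :: q.reverse) ++ [r]).IsChain G.Adj := by
    have := (List.isChain_split (l₁ := r :: s)).2 ⟨c1, c2⟩
    simpa using this
  have hnd : (r :: (s ++ t :: q.reverse)).Nodup := by
    have n1 : (r :: (s ++ [t])).Nodup := h₁.1.sublist (by simp)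
    have n2 : (r :: (q ++ [t])).Nodup := h₂.1.sublist (by simp)
    have n3 : (s ++ t :: q.reverse).Nodup := by
      refine List.Nodup.append (n1.sublist (by simp)) ?_ fun a ha ha' => ?_
      · have : (q ++ [t]).Nodup := n2.sublist (by simp)
        rw [← List.nodup_reverse] at this
        simpa using this
      · refine hd ha ?_
        simp only [List.mem_cons, List.mem_reverse] at ha'
        simp only [List.mem_append, List.mem_cons]
        tauto
    refine List.nodup_cons.2 ⟨fun hr => ?_, n3⟩
    have n1' := (List.nodup_cons.1 n1).1
    have n2' := (List.nodup_cons.1 n2).1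
    simp only [List.mem_append, List.mem_cons, List.mem_reverse, List.not_mem_nil,
      or_false] at hr n1' n2'
    tauto
  have hhead : ∃ l, s ++ t :: q.reverse = u :: l := by
    rcases s with _ | ⟨a, s⟩
    · simp only [List.nil_append, List.cons.injEq] at hs
      exact ⟨q.reverse, by simp [hs.1]⟩
    · simp only [List.cons_append, List.cons.injEq] at hs
      exact ⟨s ++ t :: q.reverse, by simp [hs.1]⟩
  have hlast : ∃ l, s ++ t :: q.reverse = l ++ [v] := by
    rcases q with _ | ⟨a, q⟩
    · simp only [List.nil_append, List.cons.injEq] at hq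
      exact ⟨s, by simp [hq.1]⟩
    · simp only [List.cons_append, List.cons.injEq] at hq
      exact ⟨s ++ t :: q.reverse, by simp [hq.1]⟩
  generalize s ++ t :: q.reverse = M at *
  obtain ⟨l, rfl⟩ := hhead
  obtain ⟨l', hl'⟩ := hlast
  have hlen : 2 ≤ (u :: l).length := by
    rcases l with _ | ⟨a, l⟩
    · exfalso
      rcases l' with _ | ⟨b, l'⟩
      · simp at hl'; exact huv hl'
      · simp at hl'
    · simp
  obtain ⟨C, hC, hadj⟩ := exists_isCycleSubgraph hnd c3 hlen
  refine ⟨C, hC, hadj _ _ (by simp), (hadj _ _ ?_).symm⟩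
  rw [hl']
  have := edgeList_append (r :: l') v [r]
  simp only [List.cons_append, List.append_assoc, List.nil_append] at this ⊢
  rw [this]
  simp

theorem exists_longest_leg [Finite V] (G : SimpleGraph V) (r : V) :
    ∃ L : V → List V, ∀ u, G.Adj r u → IsPathList G (r :: u :: L u) ∧
      ∀ l, IsPathList G (r :: u :: l) → l.length ≤ (L u).length := by
  have := Fintype.ofFinite V
  have key : ∀ u, ∃ L : List V, G.Adj r u → IsPathList G (r :: u :: L) ∧
      ∀ l, IsPathList G (r :: u :: l) → l.length ≤ L.length := by
    intro u
    by_cases hu : G.Adj r u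
    · let P : ℕ → Prop := fun k => ∃ l, IsPathList G (r :: u :: l) ∧ l.length = k
      classical
      have h0 : P 0 := ⟨[], ⟨by simp [hu.ne], by simpa using hu⟩, rfl⟩
      obtain ⟨L, hL, hLk⟩ := Nat.findGreatest_spec (P := P) (Nat.zero_le (Fintype.card V)) h0
      refine ⟨L, fun _ => ⟨hL, fun l hl => ?_⟩⟩
      rw [hLk]
      refine Nat.le_findGreatest ?_ ⟨l, hl, rfl⟩
      have := hl.1.length_le_card
      simp only [List.length_cons] at this
      omega
    · exact ⟨[], fun h => absurd h hu⟩
  choose L hL using key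
  exact ⟨L, hL⟩

/-- In the common copy of the path, `r` is an inner vertex between `u` and `v`. Cutting there leaves
the two legs; the 3 counts `r`, `u` and `v`. -/
theorem exists_legs_of_pairHL_adj {u v : V} (h : (pairHL n G).Adj s(r, u) s(r, v)) :
    u ≠ v ∧ G.Adj r u ∧ G.Adj r v ∧ ∃ L₁ L₂, IsPathList G (r :: u :: L₁) ∧
      IsPathList G (r :: v :: L₂) ∧ L₁.length + L₂.length + 3 = n := by
  have hne := h.ne
  have huv : u ≠ v := by rintro rfl; exact hne rfl
  obtain ⟨hu, hv, -, K, ⟨φ⟩, hKu, hKv⟩ := h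
  refine ⟨huv, hu, hv, ?_⟩
  replace hKu : K.Adj r u := hKu
  replace hKv : K.Adj r v := hKv
  obtain ⟨i, hi⟩ := φ.surjective ⟨r, K.edge_vert hKu⟩
  obtain ⟨j, hj⟩ := φ.surjective ⟨u, K.edge_vert hKu.symm⟩
  obtain ⟨k, hk⟩ := φ.surjective ⟨v, K.edge_vert hKv.symm⟩
  have hij : (SimpleGraph.pathGraph n).Adj i j := by
    rw [← φ.map_adj_iff, hi, hj]; exact hKu
  have hik : (SimpleGraph.pathGraph n).Adj i k := by
    rw [← φ.map_adj_iff, hi, hk]; exact hKv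
  have hjk : j ≠ k := by
    rintro rfl
    rw [hj] at hk
    exact huv (congrArg Subtype.val hk)
  set l : List V := List.ofFn fun i => (φ i : V) with hl
  have hll : l.length = n := by simp [hl]
  have hpath : IsPathList G l := by
    constructor
    · exact List.nodup_ofFn.2 fun a b hab => φ.injective (Subtype.ext hab)
    · rw [List.isChain_iff_getElem]
      intro a ha
      simp only [hl, List.getElem_ofFn]
      have : K.coe.Adj (φ ⟨a, by omega⟩) (φ ⟨a + 1, by omega⟩) := by
        rw [φ.map_adj_iff, SimpleGraph.pathGraph_adj]; simp
      exact K.coe_adj_sub _ _ this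
  have hget : ∀ a : Fin n, l[a.1]'(by omega) = φ a := fun a => by simp [hl]
  have hinf : ∀ (a b c : Fin n), a.1 + 1 = b → b.1 + 1 = c →
      l = l.take a ++ (φ a : V) :: (φ b : V) :: (φ c : V) :: l.drop (c + 1) := by
    intro a b c hab hbc
    conv_lhs => rw [← List.take_append_drop a.1 l]
    rw [List.drop_eq_getElem_cons (by omega : a.1 < l.length), hget a, hab,
      List.drop_eq_getElem_cons (by omega : b.1 < l.length), hget b, hbc,
      List.drop_eq_getElem_cons (by omega : c.1 < l.length), hget c]
  have key : ∀ (a b c : Fin n), a.1 + 1 = b → b.1 + 1 = c → ∃ L₁ L₂,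
      IsPathList G ((φ b : V) :: (φ a : V) :: L₁) ∧ IsPathList G ((φ b : V) :: (φ c : V) :: L₂) ∧
      L₁.length + L₂.length + 3 = n := by
    intro a b c hab hbc
    have h := hinf a b c hab hbc
    refine ⟨(l.take a).reverse, l.drop (c + 1), ?_, ?_, ?_⟩
    · refine hpath.reverse.infix (List.IsSuffix.isInfix
        ⟨(l.drop (c + 1)).reverse ++ [(φ c : V)], ?_⟩)
      conv_rhs => rw [h]
      simp
    · refine hpath.infix (List.IsSuffix.isInfix ⟨l.take a ++ [(φ a : V)], ?_⟩)
      conv_rhs => rw [h]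
      simp
    · simp only [List.length_reverse, List.length_take, List.length_drop]
      omega
  have hir : (φ i : V) = r := congrArg Subtype.val hi
  have hju : (φ j : V) = u := congrArg Subtype.val hj
  have hkv : (φ k : V) = v := congrArg Subtype.val hk
  rw [SimpleGraph.pathGraph_adj] at hij hik
  have hjk' : j.1 ≠ k.1 := fun h => hjk (Fin.ext h)
  rcases hij with hij | hij
  · obtain ⟨L₁, L₂, h1, h2, h3⟩ := key k i j (by omega) hij
    rw [hir, hkv] at h1
    rw [hir, hju] at h2
    exact ⟨L₂, L₁, h2, h1, by omega⟩
  · obtain ⟨L₁, L₂, h1, h2, h3⟩ := key j i k hij (by omega)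
    rw [hir, hju] at h1
    rw [hir, hkv] at h2
    exact ⟨L₁, L₂, h1, h2, h3⟩

theorem isPathList_append_legs {u v : V} {L₁ L₂ : List V} (h₁ : IsPathList G (r :: u :: L₁))
    (h₂ : IsPathList G (r :: v :: L₂)) (h : (u :: L₁).Disjoint (v :: L₂)) :
    IsPathList G ((u :: L₁).reverse ++ r :: v :: L₂) := by
  constructor
  · refine List.Nodup.append (List.nodup_reverse.2 (List.nodup_cons.1 h₁.1).2) h₂.1
      fun a ha ha' => ?_
    rw [List.mem_reverse] at ha
    rcases List.mem_cons.1 ha' with rfl | ha'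
    · exact (List.nodup_cons.1 h₁.1).1 ha
    · exact h ha ha'
  · refine List.isChain_split.2 ⟨?_, h₂.2⟩
    have := h₁.reverse.2
    rwa [List.reverse_cons] at this

variable {p : ℕ} {ι : Type} {σ : ι → ι}

/-- Legs at `r` that are cyclically long enough and disjoint form a ring in the `P_n`-line graph. -/
theorem isRing_of_legs (hn : 3 ≤ n) {u : ι → V} {L : ι → List V} (hσ : ∀ i, σ^[p + 3] i = i)
    (hnd : ∀ i, (ringList σ u (fun _ => []) i (p + 3)).Nodup)
    (hL : ∀ i, IsPathList G (r :: u i :: L i))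
    (hd : ∀ i, (u i :: L i).Disjoint (u (σ i) :: L (σ i)))
    (hlong : ∀ i, n ≤ (L i).length + (L (σ i)).length + 3) :
    IsRing n p 1 (pairHL n G) σ (fun i => s(r, u i)) (fun i => edgeList (u i :: L i))
      (fun _ => []) := by
  have hr : ∀ i, r ∉ u i :: L i := fun i => (List.nodup_cons.1 (hL i).1).1
  have hP := fun i => isPathList_append_legs (hL i) (hL (σ i)) (hd i)
  have hPl : ∀ i, n ≤ ((u i :: L i).reverse ++ r :: u (σ i) :: L (σ i)).length := fun i => by
    have := hlong i
    simp only [List.length_append, List.length_reverse, List.length_cons]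
    omega
  refine ⟨hσ, fun i => ?_, fun i => ?_, fun i => ?_, fun i => ?_, fun i j e he => ?_,
    fun i e he he' => ?_, fun i => rfl, fun i => ?_⟩
  · refine nodup_ringList_nil (fun i j hij => ?_) (hnd i)
    exact Sym2.congr_right.1 hij
  · have := (hP i).pairHL_adj hn (hPl i) (u := u i) (v := r) (w := u (σ i))
      ⟨(L i).reverse, L (σ i), by simp⟩
    rw [Sym2.eq_swap] at this
    simpa using this
  · have := (hP i).reverse.edgeList_isChain hn (l' := r :: u i :: L i)
      (by rw [List.length_reverse]; exact hPl i)
      ⟨(u (σ i) :: L (σ i)).reverse, [], by simp⟩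
    simpa using this
  · exact nodup_edgeList (List.nodup_cons.1 (hL i).1).2
  · refine ⟨?_, by simp⟩
    rintro rfl
    exact hr i (mem_of_mem_edgeList he (Sym2.mem_mk_left _ _))
  · induction e using Sym2.ind with
    | _ a b =>
    exact hd i (mem_of_mem_edgeList he (Sym2.mem_mk_left a b))
      (mem_of_mem_edgeList he' (Sym2.mem_mk_left a b))
  -- For arcs of length 1 the ring requires only the bound with `p + 3` in place of 3.
  · have := hlong i
    simp only [length_edgeList, List.length_cons]
    omega

theorem diverges_of_legs (hn : 3 ≤ n) (i₀ : ι) {u : ι → V} {L : ι → List V}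
    (hσ : ∀ i, σ^[p + 3] i = i)
    (hnd : ∀ i, (ringList σ u (fun _ => []) i (p + 3)).Nodup)
    (hL : ∀ i, IsPathList G (r :: u i :: L i)) (hne : ∀ i, L i ≠ [])
    (hd : ∀ i, (u i :: L i).Disjoint (u (σ i) :: L (σ i)))
    (hlong : ∀ i, n ≤ (L i).length + (L (σ i)).length + 3) : Diverges n G := by
  obtain ⟨z', A', B', h, hlen⟩ := (isRing_of_legs hn hσ hnd hL hd hlong).lift (toPairHL n G)
    fun _ _ => mem_range_toPairHL
  refine Diverges.of_HL (h.diverges hn i₀ _ le_rfl (fun i hi => ?_) rfl)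
  have := hlen i
  rw [hi] at this
  simp only [List.length_nil, length_edgeList, List.length_cons] at this
  exact hne i (List.length_eq_zero_iff.1 (by omega))

/-- A cycle among the edges at `r` in the `P_n`-line graph, described by the other ends of these
edges. -/
theorem exists_neighbor_cycle (h : ∃ (e : edgesAt G r)
    (p : ((HL (SimpleGraph.pathGraph n) G).induce (edgesAt G r)).Walk e e),
      p.IsCycle ∧ 4 ≤ p.length) :
    ∃ S : Set V, S.Nonempty ∧ ∀ u ∈ S, ∃ l : List V, (u :: l).Nodup ∧
      (((u :: l) ++ [u]).map fun w => s(r, w)).IsChain (pairHL n G).Adj ∧ 3 ≤ l.length ∧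
      ∀ w, w ∈ u :: l ↔ w ∈ S := by
  obtain ⟨e, p, hp, hlen⟩ := h
  have hg : ∀ e : edgesAt G r, ∃ w, s(r, w) = (e.1.1 : Sym2 V) := fun e => by
    obtain ⟨w, hw⟩ := e.2
    exact ⟨w, hw.symm⟩
  choose g hg using hg
  have hinj : Function.Injective g := fun a b hab => by
    apply Subtype.ext; apply Subtype.ext
    rw [← hg a, ← hg b, hab]
  refine ⟨{w | w ∈ p.support.map g}, ⟨g e, List.mem_map_of_mem p.start_mem_support⟩, ?_⟩
  intro u hu
  obtain ⟨f, hf, rfl⟩ := List.mem_map.1 hu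
  obtain ⟨l, h1, h2, h3, h4⟩ := exists_cycle_list hp hf
  refine ⟨l.map g, ?_, ?_, by simp; omega, fun w => ?_⟩
  · rw [← List.map_cons]; exact h1.map hinj
  · have : ((f :: l ++ [f]).map fun e => (e.1.1 : Sym2 V)).IsChain (pairHL n G).Adj := by
      rw [List.isChain_map]
      exact h2.imp fun a b hab => (toPairHL n G).map_adj_iff.2 hab
    have h5 : (g f :: l.map g ++ [g f]).map (fun w => s(r, w)) =
        (f :: l ++ [f]).map fun e => (e.1.1 : Sym2 V) := by
      simp [hg]
    rw [h5]; exact this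
  · rw [← List.map_cons]
    simp only [List.mem_map, Set.mem_ofPred_eq, h4]

end Legs

/-! ### From a cycle among the edges at a vertex to divergence -/

section Main

variable {V : Type u} {G : SimpleGraph V} {n : ℕ} {r : V}

theorem IsCycleSubgraph.not_three_neighbors {C : G.Subgraph} (hC : IsCycleSubgraph C)
    {a b c : V} (hab : a ≠ b) (hac : a ≠ c) (hbc : b ≠ c) :
    ¬ (C.Adj r a ∧ C.Adj r b ∧ C.Adj r c) := by
  rintro ⟨ha, hb, hc⟩
  obtain ⟨v, p, hp, rfl⟩ := hC
  have hr : r ∈ p.support := p.mem_verts_toSubgraph.1 (p.toSubgraph.edge_vert ha)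
  have h2 := hp.ncard_neighborSet_toSubgraph_eq_two hr
  obtain ⟨x, y, -, hxy⟩ := Set.ncard_eq_two.1 h2
  have key : ∀ w, p.toSubgraph.Adj r w → w = x ∨ w = y := fun w hw => by
    have : w ∈ p.toSubgraph.neighborSet r := hw
    rw [hxy] at this
    simpa using this
  have := key a ha
  have := key b hb
  have := key c hc
  grind

/-- If all cycles coincide, a cycle of length at least four among the edges at a vertex in the
`P_n`-line graph makes the sequence of iterated `P_n`-line graphs unbounded. -/
theorem diverges_of_neighbor_cycle [Finite V] (hn : 4 ≤ n) {C : G.Subgraph}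
    (hC : IsCycleSubgraph C) (huniq : ∀ C', IsCycleSubgraph C' → C' = C) {S : Set V}
    (hS : S.Nonempty)
    (hcyc : ∀ u ∈ S, ∃ l : List V, (u :: l).Nodup ∧
      (((u :: l) ++ [u]).map fun w => s(r, w)).IsChain (pairHL n G).Adj ∧ 3 ≤ l.length ∧
      ∀ w, w ∈ u :: l ↔ w ∈ S) : Diverges n G := by
  obtain ⟨L, hL⟩ := exists_longest_leg G r
  have hlong : ∀ {u v}, (pairHL n G).Adj s(r, u) s(r, v) →
      n ≤ (L u).length + (L v).length + 3 := fun h => by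
    obtain ⟨-, hu, hv, L₁, L₂, h1, h2, h3⟩ := exists_legs_of_pairHL_adj h
    have := (hL _ hu).2 _ h1
    have := (hL _ hv).2 _ h2
    omega
  -- Legs that meet close up to a cycle through both initial edges, and this cycle must be `C`.
  have hdisj : ∀ {u v}, G.Adj r u → G.Adj r v → u ≠ v → (¬ C.Adj r u ∨ ¬ C.Adj r v) →
      (u :: L u).Disjoint (v :: L v) := fun hu hv huv h => by
    by_contra hd
    obtain ⟨C', hC', h1, h2⟩ := exists_cycle_of_not_disjoint huv (hL _ hu).1 (hL _ hv).1 hd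
    rw [huniq C' hC'] at h1 h2
    tauto
  have hnbr : ∀ u ∈ S, ∃ x y, x ∈ S ∧ y ∈ S ∧ x ≠ u ∧ y ≠ u ∧ x ≠ y ∧
      (pairHL n G).Adj s(r, u) s(r, x) ∧ (pairHL n G).Adj s(r, y) s(r, u) := fun u hu => by
    obtain ⟨l, h1, h2, h3, h4⟩ := hcyc u hu
    rcases l with _ | ⟨x, l⟩
    · simp at h3
    rcases List.eq_nil_or_concat l with rfl | ⟨l, y, rfl⟩
    · simp at h3
    rw [List.concat_eq_append] at *
    refine ⟨x, y, (h4 x).1 (by simp), (h4 y).1 (by simp), by grind, by grind, by grind, ?_, ?_⟩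
    · have : [s(r, u), s(r, x)].IsChain (pairHL n G).Adj :=
        h2.prefix ⟨(l ++ [y, u]).map fun w => s(r, w), by simp⟩
      exact List.isChain_pair.1 this
    · have : [s(r, y), s(r, u)].IsChain (pairHL n G).Adj :=
        h2.suffix ⟨(u :: x :: l).map fun w => s(r, w), by simp⟩
      exact List.isChain_pair.1 this
  have hadj : ∀ u ∈ S, G.Adj r u := fun u hu => by
    obtain ⟨x, y, -, -, -, -, -, h, -⟩ := hnbr u hu
    exact h.1
  -- At most two of at least four edges lie on `C`, so two lie off it, and one of these avoids `u`.
  have htree : ∀ u, ∃ v ∈ S, v ≠ u ∧ ¬ C.Adj r v := fun u => by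
    obtain ⟨u₀, hu₀⟩ := hS
    obtain ⟨l, h1, -, h3, h4⟩ := hcyc u₀ hu₀
    obtain ⟨a, b, c, l, rfl⟩ : ∃ a b c l', l = a :: b :: c :: l' := by
      rcases l with _ | ⟨a, _ | ⟨b, _ | ⟨c, l⟩⟩⟩
      · simp at h3
      · simp at h3
      · simp at h3
      · exact ⟨a, b, c, l, rfl⟩
    have ha := (h4 a).1 (by simp)
    have hb := (h4 b).1 (by simp)
    have hc := (h4 c).1 (by simp)
    simp only [List.nodup_cons, List.mem_cons, not_or] at h1
    obtain ⟨⟨hua, hub, huc, -⟩, ⟨hab, hac, -⟩, ⟨hbc, -⟩, -⟩ := h1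
    have t1 := hC.not_three_neighbors (r := r) hua hub hab
    have t2 := hC.not_three_neighbors (r := r) hua huc hac
    have t3 := hC.not_three_neighbors (r := r) hub huc hbc
    have t4 := hC.not_three_neighbors (r := r) hab hac hbc
    by_contra! hcon
    have k1 := hcon u₀ hu₀
    have k2 := hcon a ha
    have k3 := hcon b hb
    have k4 := hcon c hc
    grind
  -- A leg this long becomes the arm of a lollipop on the assumed cycle. A disjoint leg off `C`, of
  -- which one vertex is enough, completes it to a path with `n` vertices.
  by_cases hbig : ∃ u ∈ S, n ≤ (L u).length + 3
  · obtain ⟨u, hu, hun⟩ := hbig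
    obtain ⟨v, hv, hvu, hCv⟩ := htree u
    obtain ⟨l, h1, h2, h3, -⟩ := hcyc u hu
    have hP := isPathList_append_legs (hL v (hadj v hv)).1 (hL u (hadj u hu)).1
      (hdisj (hadj v hv) (hadj u hu) hvu (Or.inl hCv))
    have hr : r ∉ u :: L u := (List.nodup_cons.1 (hL u (hadj u hu)).1.1).1
    have hlol : HasLollipop n (pairHL n G) (L u).length := by
      refine ⟨edgeList (u :: L u), s(r, u), l.map fun w => s(r, w), ?_, ?_, ?_, ?_, ?_, ?_⟩
      · refine List.Nodup.append (nodup_edgeList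
          (List.nodup_cons.1 (hL u (hadj u hu)).1.1).2) ?_ fun e he he' => ?_
        · rw [← List.map_cons (f := fun w => s(r, w))]
          exact h1.map fun a b hab => Sym2.congr_right.1 hab
        · rw [← List.map_cons (f := fun w => s(r, w)), List.mem_map] at he'
          obtain ⟨w, -, rfl⟩ := he'
          exact hr (mem_of_mem_edgeList he (Sym2.mem_mk_left _ _))
      · have := hP.edgeList_isChain (n := n) (l' := r :: u :: L u) (by omega)
          (by simp only [List.length_append, List.length_reverse, List.length_cons]; omega)
          (List.suffix_append _ _).isInfix
        simpa using this
      · simpa using h2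
      · simp; omega
      · simp
      · simp; omega
    -- The arm is nonempty because `n ≥ 4`.
    obtain ⟨k, hk⟩ : ∃ k, (L u).length = k + 1 := ⟨(L u).length - 1, by omega⟩
    rw [hk] at hlol
    exact Diverges.of_HL (HasLollipop.diverges (by omega) k
      (hlol.lift (toPairHL n G) fun _ _ => mem_range_toPairHL))
  · push Not at hbig
    have hne : ∀ u ∈ S, L u ≠ [] := fun u hu h => by
      obtain ⟨x, y, hx, -, -, -, -, hux, -⟩ := hnbr u hu
      have h1 := hlong hux
      have h2 := hbig x hx
      rw [h, List.length_nil] at h1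
      omega
    obtain ⟨b, ⟨hbS, hbC⟩, hbmin⟩ := Set.exists_min_image {u | u ∈ S ∧ ¬ C.Adj r u}
      (fun u => (L u).length) (Set.toFinite _) (by
        obtain ⟨u, hu⟩ := hS
        obtain ⟨v, hv, -, hvC⟩ := htree u
        exact ⟨v, hv, hvC⟩)
    obtain ⟨x, y, hx, hy, hxb, hyb, hxy, hbx, hyb'⟩ := hnbr b hbS
    have l1 := hlong hbx
    have l2 := hlong hyb'
    -- If `x` or `y` is off `C`, its leg is at least as long as that of `b`, which gives the missing
    -- bound for the pair `x`, `y`.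
    by_cases hCxy : ¬ C.Adj r x ∨ ¬ C.Adj r y
    · have l3 : n ≤ (L x).length + (L y).length + 3 := by
        rcases hCxy with h | h
        · have := hbmin x ⟨hx, h⟩
          omega
        · have := hbmin y ⟨hy, h⟩
          omega
      have d1 := hdisj (hadj b hbS) (hadj x hx) hxb.symm (Or.inl hbC)
      have d2 := hdisj (hadj x hx) (hadj y hy) hxy hCxy
      have d3 := hdisj (hadj y hy) (hadj b hbS) hyb (Or.inr hbC)
      refine diverges_of_legs (p := 0) (ι := Fin 3) (σ := fun i => i + 1) (by omega) 0
        (u := ![b, x, y]) (L := fun i => L (![b, x, y] i)) (r := r) (by decide) ?_ ?_ ?_ ?_ ?_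
      · intro i
        fin_cases i <;> simp [ringList] <;> grind
      · intro i
        fin_cases i
        exacts [(hL b (hadj b hbS)).1, (hL x (hadj x hx)).1, (hL y (hadj y hy)).1]
      · intro i
        fin_cases i
        exacts [hne b hbS, hne x hx, hne y hy]
      · intro i
        fin_cases i
        exacts [d1, d2, d3]
      · intro i
        fin_cases i
        exacts [l1, l3, l2]
    · rw [not_or, not_not, not_not] at hCxy
      -- The legs of `x` and `y` may meet along `C`. A second leg off `C` is placed between them; by
      -- minimality it satisfies the bounds known for `b`.
      obtain ⟨a, ha, hab, haC⟩ := htree b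
      have hax : a ≠ x := by rintro rfl; exact haC hCxy.1
      have hay : a ≠ y := by rintro rfl; exact haC hCxy.2
      have hmin := hbmin a ⟨ha, haC⟩
      have l3 : n ≤ (L x).length + (L a).length + 3 := by omega
      have l4 : n ≤ (L a).length + (L y).length + 3 := by omega
      have d1 := hdisj (hadj b hbS) (hadj x hx) hxb.symm (Or.inl hbC)
      have d2 := hdisj (hadj x hx) (hadj a ha) hax.symm (Or.inr haC)
      have d3 := hdisj (hadj a ha) (hadj y hy) hay (Or.inl haC)
      have d4 := hdisj (hadj y hy) (hadj b hbS) hyb (Or.inr hbC)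
      refine diverges_of_legs (p := 1) (ι := Fin 4) (σ := fun i => i + 1) (by omega) 0
        (u := ![b, x, a, y]) (L := fun i => L (![b, x, a, y] i)) (r := r) (by decide)
        ?_ ?_ ?_ ?_ ?_
      · intro i
        fin_cases i <;> simp [ringList] <;> grind
      · intro i
        fin_cases i
        exacts [(hL b (hadj b hbS)).1, (hL x (hadj x hx)).1, (hL a (hadj a ha)).1,
          (hL y (hadj y hy)).1]
      · intro i
        fin_cases i
        exacts [hne b hbS, hne x hx, hne a ha, hne y hy]
      · intro i
        fin_cases i
        exacts [d1, d2, d3, d4]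
      · intro i
        fin_cases i
        exacts [l1, l3, l4, l2]

end Main

end HLineGraph

theorem mainTheorem11 {V : Type u} [Finite V] (G : SimpleGraph V) (n : ℕ) (hn : 4 ≤ n)
    (hG : HLineGraph.MemLambda n G) (huni : HLineGraph.IsUnicyclic G)
    (r : V) (hr : HLineGraph.IsRoot G r) :
    ¬ ∃ (e : HLineGraph.edgesAt G r)
        (p : ((HLineGraph.HL (SimpleGraph.pathGraph n) G).induce
          (HLineGraph.edgesAt G r)).Walk e e),
        p.IsCycle ∧ 4 ≤ p.length := by
  intro h
  obtain ⟨-, C, hC, huniq⟩ := huni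
  obtain ⟨S, hS, hcyc⟩ := HLineGraph.exists_neighbor_cycle h
  exact (HLineGraph.diverges_of_neighbor_cycle hn hC huniq hS hcyc).not_converges
    (by omega) hG
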